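/- Let $E,M$ be integers with $E\ge 5$ and $3\le M\le 2^{E-1}$. Put $\mathfrak e_{\min}=-2^{E-1}+2$, $\mathfrak e_{\max}=2^{E-1}-1$, $\varepsilon=2^{-M-1}$, $\Omega=2^{\mathfrak e_{\max}}(2-2^{-M})$. Let $\mathbb F$ be the set of finite floats $\pm(s_0.s_1\ldots s_M)_2\cdot 2^e$ with $s_i\in\{0,1\}$, $e\in\{\mathfrak e_{\min},\dots,\mathfrak e_{\max}\}$, let $\overline{\mathbb F}=\mathbb F\cup\{-\infty,+\infty,\mathrm{NaN}\}$, and for $x\in\mathbb F$ let $x^+$ be the least non-NaN element of $\overline{\mathbb F}$ greater than $x$. Let $\mathrm{rnd}:\mathbb R\cup\{\pm\infty\}\to\overline{\mathbb F}$ be rounding to nearest, ties to even: $\mathrm{rnd}(x)$ is $-\infty$ if $x\le-\Omega-2^{\mathfrak e_{\max}}\varepsilon$, is $+\infty$ if $x\ge\Omega+2^{\mathfrak e_{\max}}\varepsilon$, and otherwise is the element of $\mathbb F$ nearest to $x$, ties being broken towards the float whose last significand digit $s_M$ is $0$. The correctly rounded version $\sigma:\overline{\mathbb F}\to\overline{\mathbb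 F}$ of $\rho:\mathbb R\to\mathbb R$ is given by $\sigma(x)=\mathrm{rnd}(\rho(x))$ for $x\in\mathbb F$, by $\sigma(\pm\infty)=\mathrm{rnd}(\lim_{t\to\pm\infty}\rho(t))$ if this limit exists in $\mathbb R\cup\{\pm\infty\}$, and by NaN otherwise. Say that $\sigma:\overline{\mathbb F}\to\overline{\mathbb F}$ satisfies Condition 1 if the following hold. (C1) There are $c_1,c_2\in\mathbb F$ with $\sigma(c_1)=0$, $|\sigma(c_2)|\in[\frac{\varepsilon}{2}+2\varepsilon^2,\frac54-2\varepsilon]$, $\max\{|c_1|,|c_2|\}\ge 2^{\mathfrak e_{\min}+1}$, such that $\sigma(x)$ lies between $\sigma(c_1)$ and $\sigma(c_2)$ for all $x\in\mathbb F$ between $c_1$ and $c_2$. Moreover there is $\eta\in\mathbb F$ for which both of the following hold. (C2) $|\eta|\in[2^{\mathfrak e_{\min}+5},4-8\varepsilon]$ and $|\sigma(\eta)|,|\sigma(\eta^+)|\in[2^{\mathfrak e_{\min}+5},2^{\mathfrak e_{\max}-6}|\eta|]$, and for all $x,y\in\mathbb F$ with $x\le\eta<\eta^+\le y$: $\sigma(x)\le\sigma(\eta)<\sigma(\eta^+)\le\sigma(y)$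 or $\sigma(x)\ge\sigma(\eta)>\sigma(\eta^+)\ge\sigma(y)$. (C3) There is a real $\lambda\in[0,2^{\mathfrak e_{\max}-7}\min\{|\sigma(\eta)|,2^{M+3}\}]$ such that for all $x,y\in\mathbb F$ with $x\le\eta<\eta^+\le y$: $|\sigma(x)-\sigma(\eta)|\le\lambda|x-\eta|$ and $|\sigma(y)-\sigma(\eta^+)|\le\lambda|y-\eta^+|$ (in particular $\sigma(x),\sigma(y)$ are finite). Then the correctly rounded versions of the following functions $\rho:\mathbb R\to\mathbb R$ satisfy Condition 1: $\mathrm{ReLU}(x)=\max\{x,0\}$; $\mathrm{LeakyReLU}(x)=x$ for $x\ge0$ and $ax$ for $x<0$, for every slope $a\in[0,1]$; $\mathrm{GELU}(x)=x\,\Phi(x)$ with $\Phi$ the standard normal distribution function; $\mathrm{ELU}(x)=x$ for $x\ge 0$ and $\alpha(e^x-1)$ for $x<0$, for every $\alpha\in[0,1]$ (in particular $\alpha=1$); $\mathrm{Mish}(x)=x\tanh(\log(1+e^x))$; $\mathrm{softplus}(x)=\log(1+e^x)$; $\mathrm{sigmoid}(x)=1/(1+e^{-x})$; and $\tanh$.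 -/

import Mathlib

open Filter Topology

namespace FloatIUA

noncomputable section

/-- The smallest exponent. -/
def emin (E : ℕ) : ℤ := -(2 : ℤ) ^ (E - 1) + 2

/-- The largest exponent. -/
def emax (E : ℕ) : ℤ := (2 : ℤ) ^ (E - 1) - 1

/-- The largest finite float. -/
def maxFloat (E M : ℕ) : ℝ := (2 : ℝ) ^ emax E * (2 - (2 : ℝ) ^ (-(M : ℤ)))

/-- The machine epsilon. -/
def eps (M : ℕ) : ℝ := (2 : ℝ) ^ (-(M : ℤ) - 1)

/-- The finite floats with `E`-bit exponent and `(M+1)`-bit significand, as a set of reals: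
the numbers `± (s₀.s₁…s_M)₂ * 2 ^ e` with `emin ≤ e ≤ emax`. A significand `(s₀.s₁…s_M)₂` is
`k / 2 ^ M` with an integer `0 ≤ k < 2 ^ (M + 1)`; the sign is absorbed in `n = ± k`. -/
def finiteFloats (E M : ℕ) : Set ℝ :=
  {x | ∃ n e : ℤ, |n| < 2 ^ (M + 1) ∧ emin E ≤ e ∧ e ≤ emax E ∧
    x = (n : ℝ) * (2 : ℝ) ^ (e - (M : ℤ))}

/-- The type of finite floats. -/
abbrev FinFloat (E M : ℕ) : Type := ↥(finiteFloats E M)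

/-- All floats: the finite ones, the two infinities, and NaN. -/
inductive ExtFloat (E M : ℕ) : Type
  | fin (x : FinFloat E M) : ExtFloat E M
  | negInf : ExtFloat E M
  | posInf : ExtFloat E M
  | nan : ExtFloat E M

/-- The comparison `≤` on floats: the order of the extended reals; false if an operand is NaN. -/
def ExtFloat.le {E M : ℕ} : ExtFloat E M → ExtFloat E M → Prop
  | .nan, _ => False
  | _, .nan => False
  | .negInf, _ => True
  | _, .posInf => True
  | .fin x, .fin y => (x : ℝ) ≤ (y : ℝ)
  | .fin _, .negInf => False
  | .posInf, .fin _ => False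
  | .posInf, .negInf => False

instance {E M : ℕ} : LE (ExtFloat E M) := ⟨ExtFloat.le⟩

/-- The comparison `<` on floats; false if an operand is NaN. -/
instance {E M : ℕ} : LT (ExtFloat E M) := ⟨fun a b => a ≤ b ∧ ¬ b ≤ a⟩

/-- `y` is the successor of `x`: the least non-NaN float above `x`. -/
def IsSucc {E M : ℕ} (x y : ExtFloat E M) : Prop :=
  IsLeast {z : ExtFloat E M | z ≠ ExtFloat.nan ∧ x < z} y

/-- The exponent of a float (for `x = 0` its value is irrelevant below, as the significand
is then `0`). -/
def expo (E : ℕ) (x : ℝ) : ℤ := max ⌊Real.logb 2 |x|⌋ (emin E)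

/-- The significand of a float. -/
def mant (E : ℕ) (x : ℝ) : ℝ := |x| / (2 : ℝ) ^ expo E x

/-- The last digit `s_M` of the significand `(s₀.s₁…s_M)₂` of `x` is `0`. -/
def LastBitZero (E M : ℕ) (x : ℝ) : Prop :=
  ∃ k : ℕ, mant E x = (2 * (k : ℝ)) * (2 : ℝ) ^ (-(M : ℤ))

/-- `y` is the finite float nearest to `x`, ties being broken towards a last bit `0`. -/
def IsNearest {E M : ℕ} (x : ℝ) (y : FinFloat E M) : Prop :=
  (∀ z : FinFloat E M, |(y : ℝ) - x| ≤ |(z : ℝ) - x|) ∧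
    ((∃ z : FinFloat E M, z ≠ y ∧ |(z : ℝ) - x| = |(y : ℝ) - x|) → LastBitZero E M (y : ℝ))

/-- The point from which on reals are rounded to infinity. -/
def overflow (E M : ℕ) : ℝ := maxFloat E M + (2 : ℝ) ^ emax E * eps M

open Classical in
/-- Rounding to nearest, ties to even. In the last case a nearest float always exists when
`2 ≤ E` and `1 ≤ M`, so that the value NaN is never taken there. -/
def rnd (E M : ℕ) (x : EReal) : ExtFloat E M :=
  if x ≤ ((-overflow E M : ℝ) : EReal) then ExtFloat.negInf
  else if ((overflow E M : ℝ) : EReal) ≤ x then ExtFloat.posInf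
  else if h : ∃ y : FinFloat E M, IsNearest x.toReal y then ExtFloat.fin h.choose
  else ExtFloat.nan

open Classical in
/-- The rounded limit of `f` along `l` if this limit exists in the extended reals, else NaN. -/
def rndLim (E M : ℕ) (f : ℝ → ℝ) (l : Filter ℝ) : ExtFloat E M :=
  if h : ∃ L : EReal, Tendsto (fun t => ((f t : ℝ) : EReal)) l (𝓝 L) then rnd E M h.choose
  else ExtFloat.nan

/-- The correctly rounded version of a real function. -/
def correctlyRounded (E M : ℕ) (f : ℝ → ℝ) : ExtFloat E M → ExtFloat E M
  | .fin x => rnd E M ((f (x : ℝ) : ℝ) : EReal)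
  | .negInf => rndLim E M f atBot
  | .posInf => rndLim E M f atTop
  | .nan => ExtFloat.nan

/-- First condition: exact zero, and a value of moderate magnitude. -/
def CondZero {E M : ℕ} (σ : ExtFloat E M → ExtFloat E M) : Prop :=
  ∃ c₁ c₂ s₁ s₂ : FinFloat E M,
    σ (.fin c₁) = .fin s₁ ∧ σ (.fin c₂) = .fin s₂ ∧
    (s₁ : ℝ) = 0 ∧
    |(s₂ : ℝ)| ∈ Set.Icc (eps M / 2 + 2 * eps M ^ 2) (5 / 4 - 2 * eps M) ∧
    (2 : ℝ) ^ (emin E + 1) ≤ max |(c₁ : ℝ)| |(c₂ : ℝ)| ∧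
    ∀ x : FinFloat E M, (x : ℝ) ∈ Set.uIcc (c₁ : ℝ) (c₂ : ℝ) →
      ∃ s : FinFloat E M, σ (.fin x) = .fin s ∧ (s : ℝ) ∈ Set.uIcc (s₁ : ℝ) (s₂ : ℝ)

/-- Second condition, for the threshold `η` with successor `η'`. -/
def CondThreshold {E M : ℕ} (σ : ExtFloat E M → ExtFloat E M) (η η' : FinFloat E M) : Prop :=
  |(η : ℝ)| ∈ Set.Icc ((2 : ℝ) ^ (emin E + 5)) (4 - 8 * eps M) ∧
  (∃ s s' : FinFloat E M, σ (.fin η) = .fin s ∧ σ (.fin η') = .fin s' ∧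
    |(s : ℝ)| ∈ Set.Icc ((2 : ℝ) ^ (emin E + 5)) ((2 : ℝ) ^ (emax E - 6) * |(η : ℝ)|) ∧
    |(s' : ℝ)| ∈ Set.Icc ((2 : ℝ) ^ (emin E + 5)) ((2 : ℝ) ^ (emax E - 6) * |(η : ℝ)|)) ∧
  ∀ x y : FinFloat E M, (x : ℝ) ≤ η → (η' : ℝ) ≤ y →
    (σ (.fin x) ≤ σ (.fin η) ∧ σ (.fin η) < σ (.fin η') ∧ σ (.fin η') ≤ σ (.fin y)) ∨
    (σ (.fin η) ≤ σ (.fin x) ∧ σ (.fin η') < σ (.fin η) ∧ σ (.fin y) ≤ σ (.fin η'))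

/-- Third condition, for the threshold `η` with successor `η'`: a linear growth bound. -/
def CondGrowth {E M : ℕ} (σ : ExtFloat E M → ExtFloat E M) (η η' : FinFloat E M) : Prop :=
  ∃ s s' : FinFloat E M, σ (.fin η) = .fin s ∧ σ (.fin η') = .fin s' ∧
    ∃ lam : ℝ, 0 ≤ lam ∧
      lam ≤ (2 : ℝ) ^ (emax E - 7) * min |(s : ℝ)| ((2 : ℝ) ^ (M + 3)) ∧
      ∀ x y : FinFloat E M, (x : ℝ) ≤ η → (η' : ℝ) ≤ y →
        ∃ u v : FinFloat E M, σ (.fin x) = .fin u ∧ σ (.fin y) = .fin v ∧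
          |(u : ℝ) - s| ≤ lam * |(x : ℝ) - η| ∧ |(v : ℝ) - s'| ≤ lam * |(y : ℝ) - η'|

/-- The condition on a floating-point activation function; the second and the third part
share the threshold `η`. (The bound `|η| ≤ 4 - 8 ε` makes the successor of `η` finite.) -/
def ActivationCondition {E M : ℕ} (σ : ExtFloat E M → ExtFloat E M) : Prop :=
  CondZero σ ∧
  ∃ η η' : FinFloat E M, IsSucc (.fin η) (.fin η') ∧ CondThreshold σ η η' ∧ CondGrowth σ η η'

/-- `ReLU`. -/
def relu (x : ℝ) : ℝ := max x 0

/-- `LeakyReLU` with slope `a` on the negative half-line. -/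
def leakyReLU (a x : ℝ) : ℝ := if 0 ≤ x then x else a * x

/-- `GELU`: `x * Φ x` with the standard normal distribution function `Φ`. -/
def gelu (x : ℝ) : ℝ := x * ProbabilityTheory.cdf (ProbabilityTheory.gaussianReal 0 1) x

/-- `ELU` with parameter `α`. -/
def elu (α x : ℝ) : ℝ := if 0 ≤ x then x else α * (Real.exp x - 1)

/-- `softplus`. -/
def softplus (x : ℝ) : ℝ := Real.log (1 + Real.exp x)

/-- `Mish`. -/
def mish (x : ℝ) : ℝ := x * Real.tanh (softplus x)

/-- The logistic `sigmoid`. -/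
def sigmoid (x : ℝ) : ℝ := 1 / (1 + Real.exp (-x))

end

end FloatIUA

/-! Why the correctly rounded activation functions satisfy the condition.

Rounding to nearest is monotone (`roundFin_mono`), fixes the floats (`roundFin_of_mem`), and moves
`v` by at most `ε * max |v| 1` (`abs_roundFin_sub_le_eps_mul`); that a nearest float respecting the tie
rule exists below the overflow threshold (`exists_isNearest`) follows from the local spacing of the
floats (`float_gap`). Hence the order relations required of the rounded function hold as soon as
the real function satisfies them. A Lipschitz bound at the threshold also survives rounding, with a
larger constant, because two distinct floats are so far apart that the rounding errors are a
bounded multiple of their distance (`activationCondition_of`).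

What remains is strictness: the values at `η` and at its successor must not be rounded to the same
float. This holds if they differ by more than the spacing of the floats at the values
(`roundFin_lt`), that is, if the slope of the function exceeds the ratio of the spacing at the
values to the spacing at `η`. The choice of `η` depends on the shape of the function.

* ReLU, LeakyReLU and ELU are the identity near `η = 1`, so nothing is rounded there
  (`activationCondition_of_rectifier`).
* GELU and Mish are `x * T x` with a monotone `1`-Lipschitz gate `T`. At `η = 1 / 2` the values lie
  below `1 / 2`, so that a slope above `1 / 2` suffices (`activationCondition_of_gate`); the same
  threshold serves `tanh`.
* Sigmoid and softplus behave like `exp` on the negative half-line. At `η = -7 / 2` the values lie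
  below `1 / 16`, so that a slope above `1 / 64` suffices; they are rounded to zero at `-2 ^ emax`
  (`activationCondition_of_exp_decay`). -/

namespace FloatIUA

/-! ### Exponent range and elementary facts on floats -/

lemma emax_eq (E : ℕ) : emax E = 1 - emin E := by
  unfold emax emin; ring

lemma emin_le {E : ℕ} (hE : 5 ≤ E) : emin E ≤ -14 := by
  have h : (2 : ℤ) ^ 4 ≤ 2 ^ (E - 1) := pow_le_pow_right₀ (by norm_num) (by omega)
  unfold emin
  omega

lemma le_two_sub_emin {E M : ℕ} (hME : M ≤ 2 ^ (E - 1)) : (M : ℤ) ≤ 2 - emin E := by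
  have h : (M : ℤ) ≤ 2 ^ (E - 1) := by exact_mod_cast hME
  unfold emin
  omega

lemma two_zpow_pos (k : ℤ) : (0 : ℝ) < 2 ^ k := by positivity

lemma two_zpow_succ (k : ℤ) : (2 : ℝ) ^ (k + 1) = 2 * 2 ^ k := by
  rw [zpow_add_one₀ two_ne_zero, mul_comm]

lemma two_zpow_sub_nat (e : ℤ) (M : ℕ) : (2 : ℝ) ^ e = 2 ^ M * 2 ^ (e - (M : ℤ)) := by
  rw [← zpow_natCast, ← zpow_add₀ two_ne_zero]
  congr 1
  ring

/-- `ε` times a power of two is half of the spacing of the floats with that exponent. -/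
lemma two_zpow_mul_eps (e : ℤ) (M : ℕ) : (2 : ℝ) ^ e * eps M = 2 ^ (e - (M : ℤ)) / 2 := by
  unfold eps
  rw [← zpow_add₀ two_ne_zero, show e + (-(M : ℤ) - 1) = e - M - 1 by ring,
    zpow_sub_one₀ two_ne_zero]
  ring

lemma eps_pos (M : ℕ) : 0 < eps M := two_zpow_pos _

lemma eps_le {M : ℕ} (hM : 3 ≤ M) : eps M ≤ 1 / 16 := by
  have h : (2 : ℝ) ^ (-(M : ℤ) - 1) ≤ 2 ^ (-4 : ℤ) :=
    zpow_le_zpow_right₀ (by norm_num) (by omega)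
  exact h.trans (by norm_num)

lemma overflow_eq (E M : ℕ) :
    overflow E M = (2 ^ (M + 1) - 1 / 2) * (2 : ℝ) ^ (emax E - (M : ℤ)) := by
  have h := two_zpow_sub_nat (emax E) M
  have h1 : (2 : ℝ) ^ M * 2 ^ (-(M : ℤ)) = 1 := by
    rw [← zpow_natCast, ← zpow_add₀ two_ne_zero]; simp
  unfold overflow maxFloat
  rw [two_zpow_mul_eps, mul_sub, h, pow_succ]
  linear_combination (-(2 : ℝ) ^ (emax E - (M : ℤ))) * h1

lemma overflow_lt_two_zpow (E M : ℕ) : overflow E M < 2 ^ (emax E + 1) := by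
  have := two_zpow_pos (emax E - (M : ℤ))
  rw [overflow_eq, two_zpow_succ, two_zpow_sub_nat (emax E) M, pow_succ]
  nlinarith

lemma maxFloat_eq (E M : ℕ) :
    maxFloat E M = (2 ^ (M + 1) - 1) * (2 : ℝ) ^ (emax E - (M : ℤ)) := by
  have h := overflow_eq E M
  unfold overflow at h
  rw [two_zpow_mul_eps] at h
  linear_combination h

lemma maxFloat_lt_overflow (E M : ℕ) : maxFloat E M < overflow E M := by
  have := mul_pos (two_zpow_pos (emax E)) (eps_pos M)
  unfold overflow
  linarith

lemma neg_mem_finiteFloats {E M : ℕ} {x : ℝ} (hx : x ∈ finiteFloats E M) :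
    -x ∈ finiteFloats E M := by
  obtain ⟨n, e, hn, h1, h2, rfl⟩ := hx
  exact ⟨-n, e, by rwa [abs_neg], h1, h2, by push_cast; ring⟩

lemma int_mul_zpow_mem {E M : ℕ} {n e : ℤ} (hn : |n| ≤ 2 ^ (M + 1)) (h1 : emin E ≤ e)
    (h2 : e < emax E) : (n : ℝ) * 2 ^ (e - (M : ℤ)) ∈ finiteFloats E M := by
  rcases hn.lt_or_eq with h | h
  · exact ⟨n, e, h, h1, h2.le, rfl⟩
  · have key : ((2 ^ (M + 1) : ℤ) : ℝ) * 2 ^ (e - (M : ℤ)) ∈ finiteFloats E M := by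
      refine ⟨2 ^ M, e + 1, ?_, by omega, by omega, ?_⟩
      · rw [abs_of_pos (by positivity), pow_succ]
        have : (0 : ℤ) < 2 ^ M := by positivity
        omega
      · rw [show e + 1 - (M : ℤ) = (e - M) + 1 by ring, two_zpow_succ]
        push_cast
        ring
    rcases abs_eq (by positivity) |>.1 h with h | h
    · rwa [h]
    · rw [h, Int.cast_neg, neg_mul]
      exact neg_mem_finiteFloats key

lemma two_zpow_mem {E M : ℕ} {k : ℤ} (h1 : emin E ≤ k) (h2 : k ≤ emax E) :
    (2 : ℝ) ^ k ∈ finiteFloats E M := by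
  refine ⟨2 ^ M, k, ?_, h1, h2, ?_⟩
  · rw [abs_of_pos (by positivity)]
    exact pow_lt_pow_right₀ (by norm_num) (by omega)
  · push_cast
    exact two_zpow_sub_nat k M

lemma emin_le_emax {E : ℕ} (hE : 5 ≤ E) : emin E ≤ emax E := by
  have := emin_le hE
  have := emax_eq E
  omega

lemma zero_mem {E M : ℕ} (hE : 5 ≤ E) : (0 : ℝ) ∈ finiteFloats E M :=
  ⟨0, emin E, by simp, le_rfl, emin_le_emax hE, by simp⟩

lemma abs_le_maxFloat {E M : ℕ} {x : ℝ} (hx : x ∈ finiteFloats E M) : |x| ≤ maxFloat E M := by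
  obtain ⟨n, e, hn, h1, h2, rfl⟩ := hx
  rw [maxFloat_eq, abs_mul, abs_of_pos (two_zpow_pos _)]
  have h3 : |(n : ℝ)| ≤ 2 ^ (M + 1) - 1 := by
    have : |n| ≤ 2 ^ (M + 1) - 1 := by omega
    exact_mod_cast this
  have h4 : (2 : ℝ) ^ (e - (M : ℤ)) ≤ 2 ^ (emax E - (M : ℤ)) :=
    zpow_le_zpow_right₀ (by norm_num) (by omega)
  have := (abs_nonneg (n : ℝ)).trans h3
  gcongr

lemma abs_lt_overflow_of_mem {E M : ℕ} {x : ℝ} (hx : x ∈ finiteFloats E M) :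
    |x| < overflow E M :=
  (abs_le_maxFloat hx).trans_lt (maxFloat_lt_overflow E M)

lemma one_mem {E M : ℕ} (hE : 5 ≤ E) : (1 : ℝ) ∈ finiteFloats E M := by
  have h0 := emin_le hE
  have h0' := emax_eq E
  simpa using two_zpow_mem (E := E) (M := M) (k := 0) (by omega) (by omega)

lemma quarter_mem {E M : ℕ} (hE : 5 ≤ E) : (1 / 4 : ℝ) ∈ finiteFloats E M := by
  have h0 := emin_le hE
  have h0' := emax_eq E
  have h := two_zpow_mem (E := E) (M := M) (k := -2) (by omega) (by omega)
  norm_num at h ⊢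
  exact h

lemma two_mem {E M : ℕ} (hE : 5 ≤ E) : (2 : ℝ) ∈ finiteFloats E M := by
  have h0 := emin_le hE
  have h0' := emax_eq E
  simpa using two_zpow_mem (E := E) (M := M) (k := 1) (by omega) (by omega)

/-- Between two consecutive multiples of `2 ^ (e - M)` there is no float, provided that both
have absolute value at least `2 ^ e`, or that `e` is the smallest exponent: floats with a larger
exponent are multiples of `2 ^ (e - M)`, those with a smaller one are below `2 ^ e`. -/
lemma float_gap {E M : ℕ} {n e : ℤ} (h : 2 ^ M ≤ n ∨ n + 1 ≤ -2 ^ M ∨ e = emin E) {z : ℝ}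
    (hz : z ∈ finiteFloats E M) :
    z ≤ n * 2 ^ (e - (M : ℤ)) ∨ ((n : ℝ) + 1) * 2 ^ (e - (M : ℤ)) ≤ z := by
  obtain ⟨m, e', hm, h1, h2, rfl⟩ := hz
  have hu := two_zpow_pos (e - (M : ℤ))
  by_cases hee : e ≤ e'
  · obtain ⟨k, rfl⟩ := Int.le.dest hee
    have : (2 : ℝ) ^ (e + k - (M : ℤ)) = 2 ^ k * 2 ^ (e - (M : ℤ)) := by
      rw [show e + k - (M : ℤ) = k + (e - M) by ring, zpow_add₀ two_ne_zero, zpow_natCast]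
    rw [this, ← mul_assoc]
    rcases le_or_gt (m * 2 ^ k) n with h3 | h3
    · left
      have : ((m : ℝ) * 2 ^ k) ≤ n := by exact_mod_cast h3
      gcongr
    · right
      have : (n : ℝ) + 1 ≤ m * 2 ^ k := by exact_mod_cast h3
      gcongr
  · have hlt : |(m : ℝ) * 2 ^ (e' - (M : ℤ))| ≤ 2 ^ M * 2 ^ (e - (M : ℤ)) := by
      rw [abs_mul, abs_of_pos (two_zpow_pos _)]
      have h3 : |(m : ℝ)| ≤ 2 ^ (M + 1) := by exact_mod_cast hm.le
      have h4 : (2 : ℝ) ^ (e' - (M : ℤ)) ≤ 2 ^ (e - (M : ℤ) - 1) :=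
        zpow_le_zpow_right₀ (by norm_num) (by omega)
      calc |(m : ℝ)| * 2 ^ (e' - (M : ℤ)) ≤ 2 ^ (M + 1) * 2 ^ (e - (M : ℤ) - 1) := by gcongr
        _ = _ := by rw [zpow_sub_one₀ two_ne_zero, pow_succ]; ring
    rcases h with h | h | h
    · left
      have : (2 : ℝ) ^ M ≤ n := by exact_mod_cast h
      exact (le_abs_self _).trans (hlt.trans (by gcongr))
    · right
      have : (n : ℝ) + 1 ≤ -2 ^ M := by exact_mod_cast h
      have h5 := (abs_le.1 hlt).1
      refine le_trans ?_ h5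
      rw [← neg_mul]
      gcongr
    · omega

/-! ### Existence of the nearest float -/

lemma expo_eq {E : ℕ} (x : ℝ) : expo E x = max (Int.log 2 |x|) (emin E) := by
  have := Real.floor_logb_natCast (b := 2) (r := |x|) (abs_nonneg x)
  unfold expo
  rw [← this]
  norm_num

lemma expo_eq_of_le {E : ℕ} {x : ℝ} {k : ℤ} (hk : emin E ≤ k) (h1 : (2 : ℝ) ^ k ≤ x)
    (h2 : x < 2 ^ (k + 1)) : expo E x = k := by
  have hx : 0 < x := (two_zpow_pos k).trans_le h1
  rw [expo_eq, abs_of_pos hx]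
  have h3 : k ≤ Int.log 2 x :=
    (Int.zpow_le_iff_le_log (b := 2) (by norm_num) hx).1 (by simpa using h1)
  have h4 : Int.log 2 x < k + 1 :=
    (Int.lt_zpow_iff_log_lt (b := 2) (by norm_num) hx).1 (by simpa using h2)
  omega

lemma expo_eq_emin {E : ℕ} {x : ℝ} (hx : 0 < x) (h2 : x < 2 ^ (emin E)) : expo E x = emin E := by
  rw [expo_eq, abs_of_pos hx]
  have h4 : Int.log 2 x < emin E :=
    (Int.lt_zpow_iff_log_lt (b := 2) (by norm_num) hx).1 (by simpa using h2)
  omega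

lemma lastBitZero_neg {E M : ℕ} {x : ℝ} (h : LastBitZero E M x) : LastBitZero E M (-x) := by
  simpa [LastBitZero, mant, expo] using h

lemma lastBitZero_of_even {E M : ℕ} (hM : 1 ≤ M) {n : ℕ} {e : ℤ} (hn : n ≤ 2 ^ (M + 1))
    (h : 2 ^ M ≤ n ∨ e = emin E) (he : emin E ≤ e) (hev : Even n) :
    LastBitZero E M ((n : ℝ) * 2 ^ (e - (M : ℤ))) := by
  have key : (2 : ℝ) ^ (e - (M : ℤ)) / 2 ^ e = 2 ^ (-(M : ℤ)) := by
    rw [← zpow_sub₀ two_ne_zero]; congr 1; ring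
  have hu := two_zpow_pos (e - (M : ℤ))
  rcases Nat.eq_zero_or_pos n with rfl | hpos
  · exact ⟨0, by simp [mant]⟩
  have hposR : (0 : ℝ) < n := by exact_mod_cast hpos
  have hxpos : 0 < (n : ℝ) * 2 ^ (e - (M : ℤ)) := by positivity
  rcases hn.lt_or_eq with hlt | rfl
  · obtain ⟨k, hk⟩ := hev
    refine ⟨k, ?_⟩
    have hexp : expo E ((n : ℝ) * 2 ^ (e - (M : ℤ))) = e := by
      by_cases h1 : 2 ^ M ≤ n
      · apply expo_eq_of_le he
        · rw [two_zpow_sub_nat e M]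
          have : (2 : ℝ) ^ M ≤ n := by exact_mod_cast h1
          gcongr
        · rw [two_zpow_succ, two_zpow_sub_nat e M, ← mul_assoc, ← pow_succ']
          have : (n : ℝ) < 2 ^ (M + 1) := by exact_mod_cast hlt
          gcongr
      · obtain rfl : e = emin E := by tauto
        apply expo_eq_emin hxpos
        rw [two_zpow_sub_nat (emin E) M]
        have : (n : ℝ) < 2 ^ M := by exact_mod_cast not_le.1 h1
        gcongr
    rw [mant, hexp, abs_of_pos hxpos, mul_div_assoc, key, hk]
    push_cast
    ring
  · have hx : ((2 ^ (M + 1) : ℕ) : ℝ) * 2 ^ (e - (M : ℤ)) = 2 ^ (e + 1) := by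
      rw [two_zpow_succ, two_zpow_sub_nat e M]; push_cast; ring
    have hexp : expo E ((2 : ℝ) ^ (e + 1)) = e + 1 :=
      expo_eq_of_le (by omega) le_rfl (zpow_lt_zpow_right₀ (by norm_num) (by omega))
    refine ⟨2 ^ (M - 1), ?_⟩
    rw [hx, mant, hexp, abs_of_pos (two_zpow_pos _), div_self (two_zpow_pos _).ne']
    obtain ⟨m, rfl⟩ : ∃ m, M = m + 1 := ⟨M - 1, by omega⟩
    rw [zpow_neg, zpow_natCast]
    push_cast
    rw [← pow_succ', mul_inv_cancel₀ (by positivity)]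

/-- A nonnegative real below the overflow threshold lies between two consecutive multiples of
the spacing that belongs to its exponent. -/
lemma exists_scale {E M : ℕ} (hE : 5 ≤ E) {v : ℝ} (hv0 : 0 ≤ v) (hv : v < overflow E M) :
    ∃ (n : ℕ) (e : ℤ), emin E ≤ e ∧ e ≤ emax E ∧ n + 1 ≤ 2 ^ (M + 1) ∧
      (2 ^ M ≤ n ∨ e = emin E) ∧ (n : ℝ) * 2 ^ (e - (M : ℤ)) ≤ v ∧
      v < ((n : ℝ) + 1) * 2 ^ (e - (M : ℤ)) := by
  have hmm := emin_le_emax hE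
  rcases hv0.eq_or_lt with rfl | hpos
  · exact ⟨0, emin E, le_rfl, hmm, by simpa using Nat.one_le_two_pow, Or.inr rfl, by simp,
      by simpa using two_zpow_pos _⟩
  have hv' := hv.trans (overflow_lt_two_zpow E M)
  set e := expo E v with he
  have he' : e = max (Int.log 2 v) (emin E) := by rw [he, expo_eq, abs_of_nonneg hv0]
  have hu := two_zpow_pos (e - (M : ℤ))
  have hlt : v < 2 ^ (e + 1) := by
    have h1 : v < (2 : ℝ) ^ (Int.log 2 v + 1) := by
      simpa using Int.lt_zpow_succ_log_self (b := 2) (by norm_num) v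
    exact h1.trans_le (zpow_le_zpow_right₀ (by norm_num) (by omega))
  have hle : e ≤ emax E := by
    rw [he', max_le_iff]
    refine ⟨?_, hmm⟩
    have : Int.log 2 v < emax E + 1 :=
      (Int.lt_zpow_iff_log_lt (b := 2) (by norm_num) hpos).1 (by simpa using hv')
    omega
  have h1 : v / 2 ^ (e - (M : ℤ)) < 2 ^ (M + 1) := by
    rw [div_lt_iff₀ hu, pow_succ', mul_assoc, ← two_zpow_sub_nat, ← two_zpow_succ]
    exact hlt
  refine ⟨⌊v / 2 ^ (e - (M : ℤ))⌋₊, e, by omega, hle, ?_, ?_, ?_, ?_⟩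
  · have : ⌊v / 2 ^ (e - (M : ℤ))⌋₊ < 2 ^ (M + 1) := by
      rw [Nat.floor_lt (by positivity)]
      exact_mod_cast h1
    omega
  · by_cases h : e = emin E
    · exact Or.inr h
    left
    rw [Nat.le_floor_iff (by positivity), le_div_iff₀ hu]
    push_cast
    rw [← two_zpow_sub_nat, show e = Int.log 2 v by omega]
    simpa using Int.zpow_log_le_self (b := 2) (by norm_num) hpos
  · rw [← le_div_iff₀ hu]
    exact Nat.floor_le (by positivity)
  · rw [← div_lt_iff₀ hu]
    exact Nat.lt_floor_add_one _

lemma natCast_mul_zpow_mem {E M : ℕ} {n : ℕ} {e : ℤ} (hn : n ≤ 2 ^ (M + 1)) (h1 : emin E ≤ e)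
    (h2 : e < emax E ∨ e = emax E ∧ n < 2 ^ (M + 1)) :
    (n : ℝ) * 2 ^ (e - (M : ℤ)) ∈ finiteFloats E M := by
  rcases h2 with h2 | ⟨rfl, h2⟩
  · have := int_mul_zpow_mem (E := E) (M := M) (n := n) (e := e)
      (by rw [abs_of_nonneg (by positivity)]; exact_mod_cast hn) h1 h2
    simpa using this
  · exact ⟨n, emax E, by rw [abs_of_nonneg (by positivity)]; exact_mod_cast h2, h1, le_rfl, by simp⟩

lemma exists_isNearest_of_nonneg {E M : ℕ} (hE : 5 ≤ E) (hM : 1 ≤ M) {v : ℝ} (hv0 : 0 ≤ v)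
    (hv : v < overflow E M) : ∃ y : FinFloat E M, IsNearest v y := by
  obtain ⟨n, e, he1, he2, hn, hor, hlo, hhi⟩ := exists_scale hE hv0 hv
  set u := (2 : ℝ) ^ (e - (M : ℤ)) with hu
  have hupos : 0 < u := two_zpow_pos _
  have hgap : ∀ z : FinFloat E M, (z : ℝ) ≤ n * u ∨ ((n : ℝ) + 1) * u ≤ z := by
    intro z
    have := float_gap (E := E) (M := M) (n := n) (e := e)
      (hor.imp (fun h => by exact_mod_cast h) Or.inr) z.2
    simpa using this
  have hmem0 : (n : ℝ) * u ∈ finiteFloats E M :=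
    natCast_mul_zpow_mem (by omega) he1 (by omega)
  -- the upper neighbour is a float unless `v` lies in the lower half of the last interval
  have hmem1 : ((n : ℝ) + 1 / 2) * u ≤ v → ((n + 1 : ℕ) : ℝ) * u ∈ finiteFloats E M := by
    intro h
    refine natCast_mul_zpow_mem hn he1 ?_
    rcases he2.lt_or_eq with h2 | h2
    · exact Or.inl h2
    · refine Or.inr ⟨h2, lt_of_le_of_ne hn ?_⟩
      intro h3
      have h4 : (n : ℝ) + 1 = 2 ^ (M + 1) := by exact_mod_cast h3
      rw [overflow_eq, ← h2, ← hu] at hv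
      have : ((n : ℝ) + 1 / 2) * u < (2 ^ (M + 1) - 1 / 2) * u := h.trans_lt hv
      rw [← h4] at this
      nlinarith
  rcases lt_trichotomy v (((n : ℝ) + 1 / 2) * u) with h | h | h
  · refine ⟨⟨_, hmem0⟩, fun z => ?_, ?_⟩
    · rw [abs_of_nonpos (by simpa using hlo), le_abs]
      rcases hgap z with hz | hz
      · right; simp only; linarith
      · left; simp only; linarith
    · rintro ⟨z, hz, heq⟩
      exfalso
      rw [abs_of_nonpos (a := (n : ℝ) * u - v) (by linarith)] at heq
      rcases hgap z with h1 | h1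
      · rw [abs_of_nonpos (by linarith)] at heq
        exact hz (Subtype.ext (by simp only; linarith))
      · rw [abs_of_nonneg (by linarith)] at heq
        linarith
  · have hmid : (n : ℝ) * u + u / 2 = v := by rw [h]; ring
    have hdist : ∀ z : FinFloat E M, u / 2 ≤ |(z : ℝ) - v| := by
      intro z
      rw [le_abs]
      rcases hgap z with hz | hz
      · right; linarith
      · left; linarith
    rcases Nat.even_or_odd n with hev | hodd
    · refine ⟨⟨_, hmem0⟩, fun z => ?_, fun _ => lastBitZero_of_even hM (by omega) hor he1 hev⟩
      refine le_trans (le_of_eq ?_) (hdist z)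
      rw [abs_of_nonpos (by simpa using hlo)]
      simp only; linarith
    · refine ⟨⟨_, hmem1 h.ge⟩, fun z => ?_, fun _ => lastBitZero_of_even hM hn
        (hor.imp_left (by omega)) he1 hodd.add_one⟩
      refine le_trans (le_of_eq ?_) (hdist z)
      push_cast
      rw [abs_of_nonneg (by linarith)]
      linarith
  · refine ⟨⟨_, hmem1 h.le⟩, fun z => ?_, ?_⟩
    · push_cast
      rw [abs_of_nonneg (by linarith), le_abs]
      rcases hgap z with hz | hz
      · right; linarith
      · left; linarith
    · rintro ⟨z, hz, heq⟩
      exfalso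
      push_cast at heq
      rw [abs_of_nonneg (a := ((n : ℝ) + 1) * u - v) (by linarith)] at heq
      rcases hgap z with h1 | h1
      · rw [abs_of_nonpos (by linarith)] at heq
        linarith
      · rw [abs_of_nonneg (by linarith)] at heq
        exact hz (Subtype.ext (by push_cast; linarith))

lemma IsNearest.neg {E M : ℕ} {v : ℝ} {y : FinFloat E M} (h : IsNearest v y) :
    IsNearest (-v) (⟨-y, neg_mem_finiteFloats y.2⟩ : FinFloat E M) := by
  have key : ∀ z : ℝ, |z - -v| = |-z - v| := fun z => by rw [← abs_neg]; congr 1; ring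
  refine ⟨fun z => ?_, ?_⟩
  · rw [key, key, neg_neg]
    exact h.1 ⟨-z, neg_mem_finiteFloats z.2⟩
  · rintro ⟨z, hz, heq⟩
    rw [key, key, neg_neg] at heq
    refine lastBitZero_neg (h.2 ⟨⟨-z, neg_mem_finiteFloats z.2⟩, fun h' => hz ?_, heq⟩)
    refine Subtype.ext ?_
    rw [← h']
    simp

lemma exists_isNearest {E M : ℕ} (hE : 5 ≤ E) (hM : 1 ≤ M) {v : ℝ} (hv : |v| < overflow E M) :
    ∃ y : FinFloat E M, IsNearest v y := by
  rcases le_total 0 v with h | h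
  · exact exists_isNearest_of_nonneg hE hM h (by rwa [abs_of_nonneg h] at hv)
  · obtain ⟨y, hy⟩ := exists_isNearest_of_nonneg (v := -v) hE hM (by linarith)
      (by rwa [abs_of_nonpos h] at hv)
    exact ⟨_, by simpa using hy.neg⟩

lemma IsNearest.le_of_lt {E M : ℕ} {v w : ℝ} {y z : FinFloat E M} (hy : IsNearest v y)
    (hz : IsNearest w z) (hvw : v < w) : (y : ℝ) ≤ z := by
  by_contra! h
  have h1 := hy.1 z
  have h2 := hz.1 y
  rw [← sq_le_sq] at h1 h2
  nlinarith [mul_pos (sub_pos.2 h) (sub_pos.2 hvw)]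

/-- A real of absolute value at most `2 ^ (e + 1)` has a float within half of the spacing that
belongs to the exponent `e`. -/
lemma exists_float_near {E M : ℕ} {v : ℝ} {e : ℤ} (he1 : emin E ≤ e) (he2 : e ≤ emax E)
    (hv : |v| < overflow E M) (hve : |v| ≤ 2 ^ (e + 1)) :
    ∃ z ∈ finiteFloats E M, |z - v| ≤ eps M * 2 ^ e := by
  set u := (2 : ℝ) ^ (e - (M : ℤ)) with hu
  have hupos : 0 < u := two_zpow_pos _
  set n := round (v / u) with hn
  have hround := abs_sub_round (v / u)
  have habs : |v / u| = |v| / u := by rw [abs_div, abs_of_pos hupos]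
  have hvu : |v / u| ≤ 2 ^ (M + 1) := by
    rw [habs, div_le_iff₀ hupos, pow_succ', mul_assoc, ← two_zpow_sub_nat, ← two_zpow_succ]
    exact hve
  have hn1 : |n| ≤ 2 ^ (M + 1) := by
    rw [abs_le] at hvu ⊢
    have h1 : (n : ℝ) < ((2 ^ (M + 1) + 1 : ℤ) : ℝ) := by
      push_cast; linarith [(abs_le.1 hround).1, hvu.2]
    have h2 : ((-2 ^ (M + 1) - 1 : ℤ) : ℝ) < (n : ℝ) := by
      push_cast; linarith [(abs_le.1 hround).2, hvu.1]
    rw [Int.cast_lt] at h1 h2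
    constructor <;> omega
  refine ⟨n * u, ?_, ?_⟩
  · rcases he2.lt_or_eq with h | h
    · exact int_mul_zpow_mem hn1 he1 h
    · refine ⟨n, e, lt_of_le_of_ne hn1 fun h3 => ?_, he1, he2, rfl⟩
      have h4 : |(n : ℝ)| = 2 ^ (M + 1) := by exact_mod_cast h3
      have h5 : |v / u| < 2 ^ (M + 1) - 1 / 2 := by
        rw [habs, div_lt_iff₀ hupos, hu, h, ← overflow_eq]
        exact hv
      have := abs_sub_abs_le_abs_sub (n : ℝ) (v / u)
      rw [abs_sub_comm] at this
      linarith
  · rw [mul_comm (eps M), two_zpow_mul_eps, ← hu]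
    have : (n : ℝ) * u - v = -((v / u - n) * u) := by
      rw [sub_mul, div_mul_cancel₀ _ hupos.ne']; ring
    rw [this, abs_neg, abs_mul, abs_of_pos hupos]
    nlinarith

/-! ### Rounding to a finite float -/

open Classical in
/-- The nearest finite float, ties to even, as a real number; `0` if there is none, which does
not happen below the overflow threshold. -/
noncomputable def roundFin (E M : ℕ) (v : ℝ) : ℝ :=
  if h : ∃ y : FinFloat E M, IsNearest v y then (h.choose : ℝ) else 0

lemma exists_rnd_eq {E M : ℕ} (hE : 5 ≤ E) (hM : 1 ≤ M) {v : ℝ} (hv : |v| < overflow E M) :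
    ∃ y : FinFloat E M, rnd E M (v : EReal) = .fin y ∧ (y : ℝ) = roundFin E M v ∧
      IsNearest v y := by
  have h := exists_isNearest hE hM hv
  refine ⟨h.choose, ?_, ?_, h.choose_spec⟩
  · rw [abs_lt] at hv
    have h1 : ¬ (v : EReal) ≤ ((-overflow E M : ℝ) : EReal) := by
      rw [EReal.coe_le_coe_iff]; linarith
    have h2 : ¬ ((overflow E M : ℝ) : EReal) ≤ (v : EReal) := by
      rw [EReal.coe_le_coe_iff]; linarith
    rw [rnd, if_neg h1, if_neg h2]
    simp only [EReal.toReal_coe]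
    exact dif_pos h
  · rw [roundFin, dif_pos h]

lemma roundFin_mem {E M : ℕ} (hE : 5 ≤ E) (v : ℝ) : roundFin E M v ∈ finiteFloats E M := by
  unfold roundFin
  split_ifs with h
  · exact h.choose.2
  · exact zero_mem hE

lemma rnd_eq {E M : ℕ} (hE : 5 ≤ E) (hM : 1 ≤ M) {v : ℝ} (hv : |v| < overflow E M) :
    rnd E M (v : EReal) = .fin ⟨roundFin E M v, roundFin_mem hE v⟩ := by
  obtain ⟨y, h1, h2, -⟩ := exists_rnd_eq hE hM hv
  rw [h1]
  congr 1
  exact Subtype.ext h2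

lemma abs_roundFin_sub_le_of_mem {E M : ℕ} (hE : 5 ≤ E) (hM : 1 ≤ M) {v z : ℝ}
    (hv : |v| < overflow E M) (hz : z ∈ finiteFloats E M) : |roundFin E M v - v| ≤ |z - v| := by
  obtain ⟨y, -, h2, h3⟩ := exists_rnd_eq hE hM hv
  rw [← h2]
  exact h3.1 ⟨z, hz⟩

lemma roundFin_of_mem {E M : ℕ} (hE : 5 ≤ E) (hM : 1 ≤ M) {v : ℝ} (hv : v ∈ finiteFloats E M) :
    roundFin E M v = v := by
  have := abs_roundFin_sub_le_of_mem hE hM (abs_lt_overflow_of_mem hv) hv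
  rw [sub_self, abs_zero] at this
  linarith [abs_eq_zero.1 (this.antisymm (abs_nonneg _))]

lemma roundFin_mono {E M : ℕ} (hE : 5 ≤ E) (hM : 1 ≤ M) {v w : ℝ} (hv : |v| < overflow E M)
    (hw : |w| < overflow E M) (h : v ≤ w) : roundFin E M v ≤ roundFin E M w := by
  rcases h.eq_or_lt with rfl | h
  · exact le_rfl
  obtain ⟨y, -, h2, h3⟩ := exists_rnd_eq hE hM hv
  obtain ⟨z, -, h5, h6⟩ := exists_rnd_eq hE hM hw
  rw [← h2, ← h5]
  exact h3.le_of_lt h6 h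

lemma le_roundFin {E M : ℕ} (hE : 5 ≤ E) (hM : 1 ≤ M) {v z : ℝ} (hv : |v| < overflow E M)
    (hz : z ∈ finiteFloats E M) (h : z ≤ v) : z ≤ roundFin E M v := by
  simpa [roundFin_of_mem hE hM hz] using roundFin_mono hE hM (abs_lt_overflow_of_mem hz) hv h

lemma roundFin_le {E M : ℕ} (hE : 5 ≤ E) (hM : 1 ≤ M) {v z : ℝ} (hv : |v| < overflow E M)
    (hz : z ∈ finiteFloats E M) (h : v ≤ z) : roundFin E M v ≤ z := by
  simpa [roundFin_of_mem hE hM hz] using roundFin_mono hE hM hv (abs_lt_overflow_of_mem hz) h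

lemma abs_roundFin_sub_le {E M : ℕ} (hE : 5 ≤ E) (hM : 1 ≤ M) {v : ℝ} {e : ℤ}
    (he1 : emin E ≤ e) (he2 : e ≤ emax E) (hv : |v| < overflow E M) (hve : |v| ≤ 2 ^ (e + 1)) :
    |roundFin E M v - v| ≤ eps M * 2 ^ e := by
  obtain ⟨z, hz, h⟩ := exists_float_near he1 he2 hv hve
  exact (abs_roundFin_sub_le_of_mem hE hM hv hz).trans h

/-- The relative rounding error is at most `ε` for `1 ≤ |v|`; below `1`, subnormal values
included, the absolute error is at most `ε`. -/
lemma abs_roundFin_sub_le_eps_mul {E M : ℕ} (hE : 5 ≤ E) (hM : 1 ≤ M) {v : ℝ}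
    (hv : |v| < overflow E M) : |roundFin E M v - v| ≤ eps M * max |v| 1 := by
  have h0 := emin_le hE
  have h0' := emax_eq E
  have hε := eps_pos M
  by_cases h1 : |v| ≤ 1
  · rw [max_eq_right h1]
    have := abs_roundFin_sub_le (e := 0) hE hM (by omega) (by omega) hv
      (h1.trans (by norm_num))
    simpa using this
  · push Not at h1
    rw [max_eq_left h1.le]
    have hpos : 0 < |v| := by linarith
    have h2 : (2 : ℝ) ^ Int.log 2 |v| ≤ |v| := by
      simpa using Int.zpow_log_le_self (b := 2) (by norm_num) hpos
    have h3 : |v| < (2 : ℝ) ^ (Int.log 2 |v| + 1) := by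
      simpa using Int.lt_zpow_succ_log_self (b := 2) (by norm_num) |v|
    have h4 : 0 ≤ Int.log 2 |v| :=
      (Int.zpow_le_iff_le_log (b := 2) (by norm_num) hpos).1 (by simpa using h1.le)
    have h5 := hv.trans (overflow_lt_two_zpow E M)
    have h6 : Int.log 2 |v| < emax E + 1 :=
      (Int.lt_zpow_iff_log_lt (b := 2) (by norm_num) hpos).1 (by simpa using h5)
    refine (abs_roundFin_sub_le hE hM (by omega) (by omega) hv h3.le).trans ?_
    gcongr

/-- Two reals in the same range that differ by more than the spacing of the floats there are
rounded to different floats. -/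
lemma roundFin_lt {E M : ℕ} (hE : 5 ≤ E) (hM : 1 ≤ M) {v w : ℝ} {e : ℤ}
    (he1 : emin E ≤ e) (he2 : e ≤ emax E) (hv : |v| < overflow E M) (hw : |w| < overflow E M)
    (hve : |v| ≤ 2 ^ (e + 1)) (hwe : |w| ≤ 2 ^ (e + 1)) (h : v + 2 * (eps M * 2 ^ e) < w) :
    roundFin E M v < roundFin E M w := by
  have h1 := abs_le.1 (abs_roundFin_sub_le hE hM he1 he2 hv hve)
  have h2 := abs_le.1 (abs_roundFin_sub_le hE hM he1 he2 hw hwe)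
  linarith [h1.2, h2.1]

lemma roundFin_eq_zero {E M : ℕ} (hE : 5 ≤ E) (hM : 1 ≤ M) {v : ℝ} (h0 : 0 ≤ v)
    (hv : v < 2 ^ (emin E - (M : ℤ) - 1)) : roundFin E M v = 0 := by
  have hu := two_zpow_pos (emin E - (M : ℤ))
  have hov : |v| < overflow E M := by
    rw [abs_of_nonneg h0]
    have h1 : (2 : ℝ) ^ (emin E - (M : ℤ) - 1) ≤ 2 ^ emax E :=
      zpow_le_zpow_right₀ (by norm_num) (by have := emin_le_emax hE; omega)
    have h2 := abs_lt_overflow_of_mem (two_zpow_mem (M := M) (emin_le_emax hE) le_rfl)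
    rw [abs_of_pos (two_zpow_pos _)] at h2
    linarith
  have h := abs_roundFin_sub_le_of_mem hE hM hov (zero_mem hE)
  rw [zero_sub, abs_neg, abs_of_nonneg h0, abs_le] at h
  rw [zpow_sub_one₀ two_ne_zero] at hv
  rcases float_gap (n := 0) (e := emin E) (Or.inr (Or.inr rfl)) (roundFin_mem (M := M) hE v)
    with h1 | h1
  · simp only [Int.cast_zero, zero_mul] at h1
    linarith
  · simp only [Int.cast_zero, zero_add, one_mul] at h1
    linarith

/-! ### A criterion for the activation condition -/

lemma correctlyRounded_fin {E M : ℕ} (hE : 5 ≤ E) (hM : 1 ≤ M) {f : ℝ → ℝ}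
    (hfin : ∀ x ∈ finiteFloats E M, |f x| < overflow E M) (x : FinFloat E M) :
    correctlyRounded E M f (.fin x) = .fin ⟨roundFin E M (f x), roundFin_mem hE _⟩ :=
  rnd_eq hE hM (hfin x x.2)

lemma condZero_of {E M : ℕ} (hE : 5 ≤ E) (hM : 3 ≤ M) {f : ℝ → ℝ} {c₁ c₂ : ℝ}
    (hfin : ∀ x ∈ finiteFloats E M, |f x| < overflow E M)
    (hc₁ : c₁ ∈ finiteFloats E M) (hc₂ : c₂ ∈ finiteFloats E M) (hle : c₁ ≤ c₂)
    (hbetween : ∀ x ∈ Set.Icc c₁ c₂, f c₁ ≤ f x ∧ f x ≤ f c₂)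
    (hzero : roundFin E M (f c₁) = 0) (hlo : 1 / 4 ≤ f c₂) (hhi : f c₂ ≤ 1)
    (hmax : (2 : ℝ) ^ (emin E + 1) ≤ max |c₁| |c₂|) :
    CondZero (correctlyRounded E M f) := by
  have hM1 : 1 ≤ M := by omega
  have hs1 := le_roundFin hE hM1 (hfin _ hc₂) (quarter_mem hE) hlo
  have hs2 := roundFin_le hE hM1 (hfin _ hc₂) (one_mem hE) hhi
  have hε := eps_pos M
  have hε' := eps_le hM
  refine ⟨⟨c₁, hc₁⟩, ⟨c₂, hc₂⟩, _, _, correctlyRounded_fin hE hM1 hfin _,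
    correctlyRounded_fin hE hM1 hfin _, hzero, ?_, hmax, ?_⟩
  · simp only
    rw [abs_of_nonneg (by linarith)]
    constructor
    · nlinarith
    · linarith
  · intro x hx
    refine ⟨_, correctlyRounded_fin hE hM1 hfin _, ?_⟩
    simp only at hx ⊢
    rw [Set.uIcc_of_le hle] at hx
    have h := hbetween _ hx
    have h2 := roundFin_mono hE hM1 (hfin _ hc₁) (hfin _ x.2) h.1
    have h3 := roundFin_mono hE hM1 (hfin _ x.2) (hfin _ hc₂) h.2
    rw [Set.uIcc_of_le (h2.trans h3)]
    exact ⟨h2, h3⟩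

lemma isSucc_of_gap {E M : ℕ} {η η' : FinFloat E M} (hlt : (η : ℝ) < η')
    (hgap : ∀ z ∈ finiteFloats E M, z ≤ η ∨ (η' : ℝ) ≤ z) :
    IsSucc (ExtFloat.fin η) (ExtFloat.fin η') := by
  refine ⟨⟨by simp, hlt.le, not_le.2 hlt⟩, ?_⟩
  rintro (z | _ | _ | _) ⟨hz, h1, h2⟩
  · rcases hgap z z.2 with h | h
    · exact absurd h h2
    · exact h
  · exact absurd h1 id
  · trivial
  · exact absurd rfl hz

/-- Rounding two values at distance at most `L * D` changes their distance by at most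
`(2 * L + c) * D`, when one of the values has absolute value at most `2` and `4 * ε ≤ c * D`. -/
lemma abs_roundFin_sub_roundFin_le {E M : ℕ} (hE : 5 ≤ E) (hM : 3 ≤ M) {v w L c D : ℝ}
    (hv : |v| < overflow E M) (hw : |w| < overflow E M) (hw2 : |w| ≤ 2) (hL : 0 ≤ L)
    (hD : 0 ≤ D) (hvw : |v - w| ≤ L * D) (hc : 4 * eps M ≤ c * D) :
    |roundFin E M v - roundFin E M w| ≤ (2 * L + c) * D := by
  have hε := eps_pos M
  have hε' : eps M ≤ 1 := (eps_le hM).trans (by norm_num)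
  have hM1 : 1 ≤ M := by omega
  have h1 := abs_roundFin_sub_le_eps_mul hE hM1 hv
  have h2 := abs_roundFin_sub_le_eps_mul hE hM1 hw
  have hLD := mul_nonneg hL hD
  have h3 : max |v| 1 ≤ 2 + L * D := by
    refine max_le ?_ (by linarith)
    have := abs_sub_abs_le_abs_sub v w
    linarith
  have h4 : max |w| 1 ≤ 2 := max_le hw2 (by norm_num)
  have h5 : |roundFin E M v - v| ≤ eps M * (2 + L * D) := h1.trans (by gcongr)
  have h6 : |roundFin E M w - w| ≤ eps M * 2 := h2.trans (by gcongr)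
  have h7 : eps M * (L * D) ≤ L * D := mul_le_of_le_one_left hLD hε'
  have h8 : roundFin E M v - roundFin E M w =
    (roundFin E M v - v) + (v - w) - (roundFin E M w - w) := by ring
  have h9 := abs_sub ((roundFin E M v - v) + (v - w)) (roundFin E M w - w)
  have h10 := abs_add_le (roundFin E M v - v) (v - w)
  rw [h8]
  linarith

/-- The floats `η < η'` are consecutive, of moderate size, and have distance at least `d` to
the next floats on either side. -/
structure IsThreshold (E M : ℕ) (η η' d : ℝ) : Prop where
  mem : η ∈ finiteFloats E M
  mem' : η' ∈ finiteFloats E M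
  lt : η < η'
  gap : ∀ z ∈ finiteFloats E M, z ≤ η ∨ η' ≤ z
  below : ∀ z ∈ finiteFloats E M, z < η → d ≤ η - z
  above : ∀ z ∈ finiteFloats E M, η' < z → d ≤ z - η'
  abs_ge : 1 / 4 ≤ |η|
  abs_le : |η| ≤ 7 / 2

/-- The function `f` lies below `f η` on the left of `η`, above `f η'` on the right of `η'`,
and deviates there from these values with slope at most `L`. -/
structure IsSeparated (f : ℝ → ℝ) (η η' L : ℝ) : Prop where
  le_left : ∀ x ≤ η, f x ≤ f η
  le_right : ∀ y, η' ≤ y → f η' ≤ f y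
  slope_left : ∀ x ≤ η, f η - f x ≤ L * (η - x)
  slope_right : ∀ y, η' ≤ y → f y - f η' ≤ L * (y - η')

/-- The criterion by which all activation functions are treated. The float `b` is a lower
bound for the values at the threshold; the constant `c` absorbs the rounding errors, which is
possible since floats other than the threshold have distance at least `d` to it. -/
theorem activationCondition_of {E M : ℕ} (hE : 5 ≤ E) (hM : 3 ≤ M) {f : ℝ → ℝ}
    {η η' d L c b : ℝ} (hfin : ∀ x ∈ finiteFloats E M, |f x| < overflow E M)
    (hzero : CondZero (correctlyRounded E M f)) (hη : IsThreshold E M η η' d)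
    (hf : IsSeparated f η η' L) (hL : 0 ≤ L) (hc : 0 ≤ c) (hcd : 4 * eps M ≤ c * d)
    (hb : b ∈ finiteFloats E M) (hb1 : 1 / 64 ≤ b) (hbf : b ≤ f η) (hf2 : f η' ≤ 2)
    (hbL : 2 * L + c ≤ 256 * b) (hlt : roundFin E M (f η) < roundFin E M (f η')) :
    ActivationCondition (correctlyRounded E M f) := by
  have h0 := emin_le hE
  have h0' := emax_eq E
  have hM1 : 1 ≤ M := by omega
  have hε := eps_pos M
  have hε' := eps_le hM
  have hff : f η ≤ f η' := by
    by_contra! h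
    exact absurd (roundFin_mono hE hM1 (hfin _ hη.mem') (hfin _ hη.mem) h.le) (not_le.2 hlt)
  have hs := le_roundFin hE hM1 (hfin _ hη.mem) hb hbf
  have hs' := roundFin_le hE hM1 (hfin _ hη.mem') (two_mem hE) hf2
  have hrange : ∀ s : ℝ, b ≤ s → s ≤ 2 →
      |s| ∈ Set.Icc ((2 : ℝ) ^ (emin E + 5)) ((2 : ℝ) ^ (emax E - 6) * |η|) := by
    intro s hs1 hs2
    rw [abs_of_nonneg (a := s) (by linarith)]
    constructor
    · have : (2 : ℝ) ^ (emin E + 5) ≤ 2 ^ (-6 : ℤ) :=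
        zpow_le_zpow_right₀ (by norm_num) (by omega)
      norm_num at this
      linarith
    · have : (2 : ℝ) ^ (3 : ℤ) ≤ 2 ^ (emax E - 6) :=
        zpow_le_zpow_right₀ (by norm_num) (by omega)
      norm_num at this
      nlinarith [hη.abs_ge]
  refine ⟨hzero, ⟨η, hη.mem⟩, ⟨η', hη.mem'⟩, isSucc_of_gap hη.lt hη.gap,
    ⟨⟨?_, ?_⟩, ⟨_, _, correctlyRounded_fin hE hM1 hfin _, correctlyRounded_fin hE hM1 hfin _,
      hrange _ hs (hlt.le.trans hs'), hrange _ (hs.trans hlt.le) hs'⟩, ?_⟩,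
    ⟨_, _, correctlyRounded_fin hE hM1 hfin _, correctlyRounded_fin hE hM1 hfin _,
      2 * L + c, by linarith, ?_, ?_⟩⟩
  · have : (2 : ℝ) ^ (emin E + 5) ≤ 2 ^ (-6 : ℤ) :=
      zpow_le_zpow_right₀ (by norm_num) (by omega)
    norm_num at this
    linarith [hη.abs_ge]
  · linarith [hη.abs_le]
  · intro x y hx hy
    left
    simp only [correctlyRounded_fin hE hM1 hfin]
    exact ⟨roundFin_mono hE hM1 (hfin _ x.2) (hfin _ hη.mem) (hf.le_left _ hx),
      ⟨hlt.le, not_le.2 hlt⟩,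
      roundFin_mono hE hM1 (hfin _ hη.mem') (hfin _ y.2) (hf.le_right _ hy)⟩
  · have h3 : (2 : ℝ) ^ (8 : ℤ) ≤ 2 ^ (emax E - 7) :=
      zpow_le_zpow_right₀ (by norm_num) (by omega)
    norm_num at h3
    have h4 : b ≤ min |roundFin E M (f η)| ((2 : ℝ) ^ (M + 3)) := by
      refine le_min (hs.trans (le_abs_self _)) ?_
      have : (2 : ℝ) ^ 1 ≤ 2 ^ (M + 3) := pow_le_pow_right₀ (by norm_num) (by omega)
      linarith
    calc 2 * L + c ≤ 256 * b := hbL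
      _ ≤ _ := by gcongr
  · intro x y hx hy
    refine ⟨_, _, correctlyRounded_fin hE hM1 hfin _, correctlyRounded_fin hE hM1 hfin _, ?_, ?_⟩
    · simp only at hx ⊢
      rcases hx.eq_or_lt with h | h
      · rw [h]; simp
      have hd := hη.below _ x.2 h
      rw [abs_of_neg (sub_neg.2 h), neg_sub]
      refine abs_roundFin_sub_roundFin_le hE hM (hfin _ x.2) (hfin _ hη.mem) ?_ hL
        (by linarith) ?_ (hcd.trans (by gcongr))
      · rw [abs_of_nonneg (by linarith)]; linarith
      · rw [abs_of_nonpos (by linarith [hf.le_left _ hx]), neg_sub]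
        exact hf.slope_left _ hx
    · simp only at hy ⊢
      rcases hy.eq_or_lt with h | h
      · rw [← h]; simp
      have hd := hη.above _ y.2 h
      rw [abs_of_pos (sub_pos.2 h)]
      refine abs_roundFin_sub_roundFin_le hE hM (hfin _ y.2) (hfin _ hη.mem') ?_ hL
        (by linarith) ?_ (hcd.trans (by gcongr))
      · rw [abs_of_nonneg (by linarith)]; linarith
      · rw [abs_of_nonneg (by linarith [hf.le_right _ hy])]
        exact hf.slope_right _ hy

/-! ### The thresholds -/

lemma isThreshold_two_zpow {E M : ℕ} (hE : 5 ≤ E) (hM : 3 ≤ M) {e : ℤ} (h1 : -2 ≤ e)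
    (h2 : e ≤ 1) :
    IsThreshold E M (2 ^ e) (2 ^ e * (1 + 2 * eps M)) (2 ^ e * eps M) := by
  have h0 := emin_le hE
  have h0' := emax_eq E
  set u := (2 : ℝ) ^ (e - (M : ℤ)) with hu
  have hupos : 0 < u := two_zpow_pos _
  have hη : (2 : ℝ) ^ e = 2 ^ M * u := two_zpow_sub_nat e M
  have hd : (2 : ℝ) ^ e * eps M = u / 2 := two_zpow_mul_eps e M
  have hη' : (2 : ℝ) ^ e * (1 + 2 * eps M) = (2 ^ M + 1) * u := by
    linear_combination hη + 2 * hd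
  have hpow : (2 : ℤ) ^ 3 ≤ 2 ^ M := pow_le_pow_right₀ (by norm_num) hM
  have hlo : (2 : ℝ) ^ (-2 : ℤ) ≤ 2 ^ e := zpow_le_zpow_right₀ (by norm_num) h1
  have hhi : (2 : ℝ) ^ e ≤ 2 ^ (1 : ℤ) := zpow_le_zpow_right₀ (by norm_num) h2
  norm_num at hlo hhi
  refine ⟨two_zpow_mem (by omega) (by omega), ?_, ?_, ?_, ?_, ?_, ?_, ?_⟩
  · rw [hη']
    refine ⟨2 ^ M + 1, e, ?_, by omega, by omega, by push_cast; rfl⟩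
    rw [abs_of_pos (by positivity), pow_succ]
    omega
  · rw [hη', hη]
    nlinarith
  · intro z hz
    rw [hη', hη]
    have := float_gap (n := 2 ^ M) (e := e) (Or.inl le_rfl) hz
    push_cast at this
    exact this
  · intro z hz hlt
    -- below a power of two the spacing is half of the spacing above
    have := float_gap (n := 2 ^ (M + 1) - 1) (e := e - 1) (Or.inl (by rw [pow_succ]; omega)) hz
    rw [show e - 1 - (M : ℤ) = e - M - 1 by ring, zpow_sub_one₀ two_ne_zero, ← hu] at this
    push_cast at this
    rw [pow_succ] at this
    rw [hd]
    rw [hη] at hlt ⊢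
    rcases this with h | h <;> linarith
  · intro z hz hlt
    have := float_gap (n := 2 ^ M + 1) (e := e) (Or.inl (by omega)) hz
    push_cast at this
    rw [hd]
    rw [hη'] at hlt ⊢
    rcases this with h | h <;> linarith
  · rw [abs_of_pos (two_zpow_pos e)]; linarith
  · rw [abs_of_pos (two_zpow_pos e)]; linarith

lemma isThreshold_neg {E M : ℕ} (hE : 5 ≤ E) (hM : 3 ≤ M) :
    IsThreshold E M (-7 / 2) (-7 / 2 + 4 * eps M) (4 * eps M) := by
  have h0 := emin_le hE
  have h0' := emax_eq E
  obtain ⟨m, rfl⟩ : ∃ m, M = m + 2 := ⟨M - 2, by omega⟩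
  set u := (2 : ℝ) ^ ((1 : ℤ) - ((m : ℤ) + 2)) with hu
  have hupos : 0 < u := two_zpow_pos _
  have hm : (2 : ℤ) ^ 1 ≤ 2 ^ m := pow_le_pow_right₀ (by norm_num) (by omega)
  have hd : 4 * eps (m + 2) = u := by
    have := two_zpow_mul_eps 1 (m + 2)
    push_cast at this
    rw [← hu] at this
    norm_num at this
    linarith
  have hη : (-7 / 2 : ℝ) = (-7 * 2 ^ m) * u := by
    have := two_zpow_sub_nat 1 (m + 2)
    push_cast at this
    rw [← hu, pow_add] at this
    norm_num at this
    linarith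
  have hpow : (2 : ℤ) ^ (m + 2) = 4 * 2 ^ m := by rw [pow_add]; ring
  have hpow' : (2 : ℤ) ^ (m + 2 + 1) = 8 * 2 ^ m := by rw [pow_add, pow_add]; ring
  rw [hd]
  refine ⟨?_, ?_, by linarith, ?_, ?_, ?_, ?_, ?_⟩
  · refine ⟨-7 * 2 ^ m, 1, ?_, by omega, by omega, by push_cast; exact hη⟩
    rw [abs_lt]
    omega
  · refine ⟨-7 * 2 ^ m + 1, 1, ?_, by omega, by omega, by push_cast; rw [hη, ← hu]; ring⟩
    rw [abs_lt]
    omega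
  · intro z hz
    have := float_gap (n := -7 * 2 ^ m) (e := 1) (Or.inr (Or.inl (by omega))) hz
    push_cast at this
    rw [← hu] at this
    rw [hη]
    rcases this with h | h
    · left; linarith
    · right; linarith
  · intro z hz hlt
    have := float_gap (n := -7 * 2 ^ m - 1) (e := 1) (Or.inr (Or.inl (by omega))) hz
    push_cast at this
    rw [← hu] at this
    rw [hη] at hlt ⊢
    rcases this with h | h <;> linarith
  · intro z hz hlt
    have := float_gap (n := -7 * 2 ^ m + 1) (e := 1) (Or.inr (Or.inl (by omega))) hz
    push_cast at this
    rw [← hu] at this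
    rw [hη] at hlt ⊢
    rcases this with h | h <;> linarith
  · rw [abs_of_neg] <;> norm_num
  · rw [abs_of_neg] <;> norm_num

/-! ### Exact zero and value of moderate size at `0` and `1` -/

lemma two_lt_overflow {E M : ℕ} (hE : 5 ≤ E) : 2 < overflow E M := by
  simpa using abs_lt_overflow_of_mem (two_mem (M := M) hE)

lemma two_zpow_emin_add_one_le {E : ℕ} (hE : 5 ≤ E) : (2 : ℝ) ^ (emin E + 1) ≤ 1 := by
  have h0 := emin_le hE
  have : (2 : ℝ) ^ (emin E + 1) ≤ 2 ^ (0 : ℤ) := zpow_le_zpow_right₀ (by norm_num) (by omega)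
  simpa using this

/-- A function that vanishes at `0` and is monotone on `[0, 1]` with `f 1 ∈ [1/4, 1]` has the
required zero and value of moderate size at `0` and `1`. -/
lemma condZero_of_monotoneOn {E M : ℕ} (hE : 5 ≤ E) (hM : 3 ≤ M) {f : ℝ → ℝ}
    (hfin : ∀ x ∈ finiteFloats E M, |f x| < overflow E M) (hmono : MonotoneOn f (Set.Icc 0 1))
    (h0 : f 0 = 0) (hlo : 1 / 4 ≤ f 1) (hhi : f 1 ≤ 1) :
    CondZero (correctlyRounded E M f) := by
  refine condZero_of hE hM hfin (zero_mem hE) (one_mem hE) zero_le_one (fun x hx => ?_) ?_ hlo hhi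
    (by simpa using two_zpow_emin_add_one_le hE)
  · exact ⟨hmono ⟨le_rfl, zero_le_one⟩ hx hx.1, hmono hx ⟨zero_le_one, le_rfl⟩ hx.2⟩
  · rw [h0]
    exact roundFin_of_mem hE (by omega) (zero_mem hE)

/-! ### Rectified linear functions -/

/-- Here the threshold is `1`, near which `f` is the identity. -/
theorem activationCondition_of_rectifier {E M : ℕ} (hE : 5 ≤ E) (hM : 3 ≤ M) {f : ℝ → ℝ}
    (hpos : ∀ x, 0 ≤ x → f x = x) (hneg : ∀ x, x < 0 → x ≤ f x ∧ f x ≤ 0) :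
    ActivationCondition (correctlyRounded E M f) := by
  have hM1 : 1 ≤ M := by omega
  have hε := eps_pos M
  have hε' := eps_le hM
  have hη : IsThreshold E M 1 (1 + 2 * eps M) (eps M) := by
    simpa using isThreshold_two_zpow hE hM (e := 0) (by norm_num) (by norm_num)
  have hfin : ∀ x ∈ finiteFloats E M, |f x| < overflow E M := by
    intro x hx
    refine lt_of_le_of_lt ?_ (abs_lt_overflow_of_mem hx)
    rcases le_or_gt 0 x with h | h
    · rw [hpos x h]
    · rw [abs_of_nonpos (hneg x h).2, abs_of_neg h]
      linarith [(hneg x h).1]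
  have h1 : f 1 = 1 := hpos 1 zero_le_one
  have h1' : f (1 + 2 * eps M) = 1 + 2 * eps M := hpos _ (by linarith)
  refine activationCondition_of hE hM (L := 1) (c := 4) (b := 1) hfin ?_ hη ⟨?_, ?_, ?_, ?_⟩
    zero_le_one (by norm_num) le_rfl (one_mem hE) (by norm_num) h1.ge (by linarith)
    (by norm_num) ?_
  · refine condZero_of_monotoneOn hE hM hfin ?_ (hpos 0 le_rfl) (by rw [h1]; norm_num) h1.le
    intro x hx y hy hxy
    rwa [hpos x hx.1, hpos y hy.1]
  · intro x hx
    rcases le_or_gt 0 x with h | h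
    · rwa [hpos x h, h1]
    · linarith [hneg x h]
  · intro y hy
    rw [hpos y (by linarith), h1']
    exact hy
  · intro x hx
    rcases le_or_gt 0 x with h | h
    · rw [hpos x h, h1]; linarith
    · linarith [hneg x h]
  · intro y hy
    rw [hpos y (by linarith), h1']
    linarith
  · rw [h1, h1', roundFin_of_mem hE hM1 hη.mem, roundFin_of_mem hE hM1 hη.mem']
    exact hη.lt

lemma activationCondition_relu {E M : ℕ} (hE : 5 ≤ E) (hM : 3 ≤ M) :
    ActivationCondition (correctlyRounded E M relu) :=
  activationCondition_of_rectifier hE hM (fun _ hx => max_eq_left hx)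
    (fun _ hx => ⟨le_max_left _ _, (max_eq_right hx.le).le⟩)

lemma activationCondition_leakyReLU {E M : ℕ} (hE : 5 ≤ E) (hM : 3 ≤ M) {a : ℝ} (ha0 : 0 ≤ a)
    (ha1 : a ≤ 1) : ActivationCondition (correctlyRounded E M (leakyReLU a)) := by
  refine activationCondition_of_rectifier hE hM (fun x hx => if_pos hx) (fun x hx => ?_)
  rw [leakyReLU, if_neg hx.not_ge]
  constructor <;> nlinarith

lemma activationCondition_elu {E M : ℕ} (hE : 5 ≤ E) (hM : 3 ≤ M) {α : ℝ} (hα0 : 0 ≤ α)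
    (hα1 : α ≤ 1) : ActivationCondition (correctlyRounded E M (elu α)) := by
  refine activationCondition_of_rectifier hE hM (fun x hx => if_pos hx) (fun x hx => ?_)
  rw [elu, if_neg hx.not_ge]
  have h1 := Real.add_one_le_exp x
  have h2 := Real.exp_le_one_iff.2 hx.le
  constructor <;> nlinarith

/-! ### Gated identities -/

lemma isThreshold_half {E M : ℕ} (hE : 5 ≤ E) (hM : 3 ≤ M) :
    IsThreshold E M (1 / 2) (1 / 2 + eps M) (eps M / 2) := by
  have h := isThreshold_two_zpow hE hM (e := -1) (by norm_num) (by norm_num)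
  rw [show (2 : ℝ) ^ (-1 : ℤ) = 1 / 2 by norm_num,
    show (1 / 2 : ℝ) * (1 + 2 * eps M) = 1 / 2 + eps M by ring,
    show (1 / 2 : ℝ) * eps M = eps M / 2 by ring] at h
  exact h

/-- Functions `x ↦ x * T x` with a monotone gate `T`. With the threshold `1 / 2` the values stay
below `1 / 2`, where the floats are spaced half as far apart as above; hence a slope larger than
`1 / 2`, which `T` provides, separates the rounded values. -/
theorem activationCondition_of_gate {E M : ℕ} (hE : 5 ≤ E) (hM : 3 ≤ M) {T : ℝ → ℝ}
    (hmono : Monotone T) (h0 : ∀ x, 0 ≤ T x) (h1 : ∀ x, T x ≤ 1)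
    (hlip : ∀ a b, a ≤ b → T b - T a ≤ b - a) (hlo : 1 / 2 < T (1 / 2))
    (hhi : T (9 / 16) ≤ 8 / 9) :
    ActivationCondition (correctlyRounded E M fun x => x * T x) := by
  have hM1 : 1 ≤ M := by omega
  have h0E := emin_le hE
  have h0E' := emax_eq E
  have hε := eps_pos M
  have hε' := eps_le hM
  have hη := isThreshold_half hE hM
  have hfin : ∀ x ∈ finiteFloats E M, |x * T x| < overflow E M := by
    intro x hx
    refine lt_of_le_of_lt ?_ (abs_lt_overflow_of_mem hx)
    rw [abs_mul, abs_of_nonneg (h0 x)]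
    exact mul_le_of_le_one_right (abs_nonneg x) (h1 x)
  have hmonoOn : ∀ x y, 0 ≤ y → x ≤ y → x * T x ≤ y * T y := by
    intro x y hy hxy
    rcases le_or_gt 0 x with h | h
    · exact mul_le_mul hxy (hmono hxy) (h0 x) hy
    · exact (mul_nonpos_of_nonpos_of_nonneg h.le (h0 x)).trans (mul_nonneg hy (h0 y))
  have hT1 : 1 / 2 < T 1 := hlo.trans_le (hmono (by norm_num))
  have hTη : T (1 / 2 + eps M) ≤ 8 / 9 := (hmono (by linarith)).trans hhi
  have hTη' : T (1 / 2) ≤ T (1 / 2 + eps M) := hmono (by linarith)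
  have hw : (1 / 2 + eps M) * T (1 / 2 + eps M) ≤ 1 / 2 :=
    calc _ ≤ (9 / 16 : ℝ) * (8 / 9) := by
          apply mul_le_mul (by linarith) hTη (h0 _) (by norm_num)
      _ = _ := by norm_num
  refine activationCondition_of hE hM (L := 2) (c := 8) (b := 1 / 4) hfin ?_ hη ⟨?_, ?_, ?_, ?_⟩
    zero_le_two (by norm_num) (by linarith) (quarter_mem hE) (by norm_num) (by linarith)
    (by linarith) (by norm_num) ?_
  · exact condZero_of_monotoneOn hE hM hfin (fun x hx y hy hxy => hmonoOn x y hy.1 hxy)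
      (by simp) (by linarith) (by linarith [h1 1])
  · exact fun x hx => hmonoOn x _ (by norm_num) hx
  · exact fun y hy => hmonoOn _ y (by linarith) hy
  · intro x hx
    rcases le_or_gt 0 x with h | h
    · have := hlip x (1 / 2) hx
      nlinarith [h1 (1 / 2)]
    · nlinarith [h1 (1 / 2), h1 x]
  · intro y hy
    have := hlip _ y hy
    nlinarith [h1 y]
  · refine roundFin_lt hE hM1 (e := -2) (by omega) (by omega) (hfin _ hη.mem) (hfin _ hη.mem')
      ?_ ?_ ?_
    · rw [abs_of_nonneg (by linarith)]
      norm_num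
      linarith
    · rw [abs_of_nonneg (by nlinarith)]
      norm_num at hw ⊢
      linarith
    · norm_num
      nlinarith

/-! ### The hyperbolic tangent -/

lemma hasDerivAt_tanh (x : ℝ) : HasDerivAt Real.tanh (1 - Real.tanh x ^ 2) x := by
  have hc := (Real.cosh_pos x).ne'
  have h := (Real.hasDerivAt_sinh x).div (Real.hasDerivAt_cosh x) hc
  have h2 : Real.tanh = Real.sinh / Real.cosh := by
    ext y; exact Real.tanh_eq_sinh_div_cosh y
  rw [h2]
  refine h.congr_deriv ?_
  rw [Pi.div_apply]
  field_simp

lemma monotone_tanh : Monotone Real.tanh := by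
  refine monotone_of_deriv_nonneg (fun x => (hasDerivAt_tanh x).differentiableAt) fun x => ?_
  rw [(hasDerivAt_tanh x).deriv]
  linarith [Real.tanh_sq_lt_one x]

lemma tanh_sub_tanh_le {a b : ℝ} (h : a ≤ b) : Real.tanh b - Real.tanh a ≤ b - a := by
  have h1 : Monotone fun x => x - Real.tanh x := by
    have hd : ∀ x, HasDerivAt (fun x => x - Real.tanh x) (1 - (1 - Real.tanh x ^ 2)) x :=
      fun x => (hasDerivAt_id x).sub (hasDerivAt_tanh x)
    refine monotone_of_deriv_nonneg (fun x => (hd x).differentiableAt) fun x => ?_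
    rw [(hd x).deriv]
    nlinarith [sq_nonneg (Real.tanh x)]
  have := h1 h
  simp only at this
  linarith

/-- On `[1/2, 9/16]` the derivative of `tanh` is at least `1 - (9/16)²`. -/
lemma le_tanh_sub_tanh_half {b : ℝ} (h : 1 / 2 ≤ b) (hb : b ≤ 9 / 16) :
    (175 / 256) * (b - 1 / 2) ≤ Real.tanh b - Real.tanh (1 / 2) := by
  have hd : ∀ x, HasDerivAt (fun x => Real.tanh x - 175 / 256 * x)
      ((1 - Real.tanh x ^ 2) - 175 / 256 * 1) x :=
    fun x => (hasDerivAt_tanh x).sub ((hasDerivAt_id x).const_mul _)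
  have h1 : MonotoneOn (fun x => Real.tanh x - 175 / 256 * x) (Set.Icc (1 / 2) (9 / 16)) := by
    refine monotoneOn_of_deriv_nonneg (convex_Icc _ _)
      (fun x _ => (hd x).continuousAt.continuousWithinAt)
      (fun x _ => (hd x).differentiableAt.differentiableWithinAt) fun x hx => ?_
    rw [interior_Icc] at hx
    rw [(hd x).deriv]
    have h2 := tanh_sub_tanh_le (a := 0) (b := x) (by linarith [hx.1])
    have h3 := monotone_tanh (a := 0) (b := x) (by linarith [hx.1])
    rw [Real.tanh_zero] at h2 h3
    nlinarith [hx.2]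
  have := h1 ⟨le_rfl, by norm_num⟩ ⟨h, hb⟩ h
  simp only at this
  linarith

lemma tanh_eq_exp_two_mul (x : ℝ) :
    Real.tanh x = (Real.exp (2 * x) - 1) / (Real.exp (2 * x) + 1) := by
  have h : Real.exp (2 * x) = Real.exp x * Real.exp x := by rw [← Real.exp_add]; ring_nf
  have hx := Real.exp_pos x
  rw [Real.tanh_eq, Real.exp_neg, h]
  field_simp

theorem activationCondition_tanh {E M : ℕ} (hE : 5 ≤ E) (hM : 3 ≤ M) :
    ActivationCondition (correctlyRounded E M Real.tanh) := by
  have hM1 : 1 ≤ M := by omega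
  have h0E := emin_le hE
  have h0E' := emax_eq E
  have hε := eps_pos M
  have hε' := eps_le hM
  have hη := isThreshold_half hE hM
  have hov := two_lt_overflow (M := M) hE
  have hfin : ∀ x ∈ finiteFloats E M, |Real.tanh x| < overflow E M :=
    fun x _ => (Real.abs_tanh_lt_one x).trans (by linarith)
  have hval : Real.tanh (1 / 2) = (Real.exp 1 - 1) / (Real.exp 1 + 1) := by
    rw [tanh_eq_exp_two_mul]; norm_num
  have hlo : 1 / 4 ≤ Real.tanh (1 / 2) := by
    rw [hval, le_div_iff₀ (by positivity)]
    linarith [Real.exp_one_gt_d9]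
  have hhi : Real.tanh (1 / 2) < 15 / 32 := by
    rw [hval, div_lt_iff₀ (by positivity)]
    linarith [Real.exp_one_lt_d9]
  refine activationCondition_of hE hM (L := 1) (c := 8) (b := 1 / 4) hfin ?_ hη ⟨?_, ?_, ?_, ?_⟩
    zero_le_one (by norm_num) (by linarith) (quarter_mem hE) (by norm_num) hlo
    (by linarith [Real.tanh_lt_one (1 / 2 + eps M)]) (by norm_num) ?_
  · exact condZero_of_monotoneOn hE hM hfin (monotone_tanh.monotoneOn _) Real.tanh_zero
      (hlo.trans (monotone_tanh (by norm_num))) (Real.tanh_lt_one 1).le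
  · exact fun x hx => monotone_tanh hx
  · exact fun y hy => monotone_tanh hy
  · exact fun x hx => by rw [one_mul]; exact tanh_sub_tanh_le hx
  · exact fun y hy => by rw [one_mul]; exact tanh_sub_tanh_le hy
  · have hgap := le_tanh_sub_tanh_half (b := 1 / 2 + eps M) (by linarith) (by linarith)
    -- the value at the successor may exceed `1 / 2`, above which the floats are sparser
    set w := min (Real.tanh (1 / 2 + eps M)) (1 / 2) with hw
    have hvw : Real.tanh (1 / 2) + eps M / 2 < w := lt_min (by linarith) (by linarith)
    have hw2 : w ≤ 1 / 2 := min_le_right _ _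
    have hwov : |w| < overflow E M := by
      rw [abs_of_nonneg (by linarith)]; linarith
    refine lt_of_lt_of_le ?_ (roundFin_mono hE hM1 hwov (hfin _ hη.mem') (min_le_left _ _))
    refine roundFin_lt hE hM1 (e := -2) (by omega) (by omega) (hfin _ hη.mem) hwov ?_ ?_ ?_
    · rw [abs_of_nonneg (by linarith)]
      norm_num at hhi ⊢
      linarith
    · rw [abs_of_nonneg (by linarith)]
      norm_num at hw2 ⊢
      linarith
    · norm_num at hvw ⊢
      linarith

/-! ### Softplus, sigmoid and Mish -/

lemma monotone_softplus : Monotone softplus := by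
  intro a b h
  have := Real.exp_pos a
  unfold softplus
  gcongr

lemma softplus_sub_le {a b : ℝ} (h : a ≤ b) : softplus b - softplus a ≤ b - a := by
  have ha := Real.exp_pos a
  have hb := Real.exp_pos b
  unfold softplus
  rw [← Real.log_div (by positivity) (by positivity), Real.log_le_iff_le_exp (by positivity),
    div_le_iff₀ (by positivity), mul_add, ← Real.exp_add, mul_one]
  have h1 : 1 ≤ Real.exp (b - a) := Real.one_le_exp (by linarith)
  rw [sub_add_cancel]
  linarith

lemma softplus_nonneg (x : ℝ) : 0 ≤ softplus x :=
  Real.log_nonneg (by linarith [Real.exp_pos x])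

lemma softplus_le_exp (x : ℝ) : softplus x ≤ Real.exp x := by
  have := Real.log_le_sub_one_of_pos (x := 1 + Real.exp x) (by positivity)
  unfold softplus
  linarith

lemma tanh_log {u : ℝ} (hu : 0 < u) : Real.tanh (Real.log u) = (u ^ 2 - 1) / (u ^ 2 + 1) := by
  rw [tanh_eq_exp_two_mul, two_mul, Real.exp_add, Real.exp_log hu, sq]

theorem activationCondition_mish {E M : ℕ} (hE : 5 ≤ E) (hM : 3 ≤ M) :
    ActivationCondition (correctlyRounded E M mish) := by
  have hval : ∀ x, Real.tanh (softplus x) =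
      ((1 + Real.exp x) ^ 2 - 1) / ((1 + Real.exp x) ^ 2 + 1) :=
    fun x => tanh_log (by positivity)
  have hmono : Monotone fun x => Real.tanh (softplus x) := monotone_tanh.comp monotone_softplus
  refine activationCondition_of_gate hE hM (T := fun x => Real.tanh (softplus x)) hmono
    (fun x => ?_) (fun x => (Real.tanh_lt_one _).le) (fun a b h => ?_) ?_ ?_
  · rw [← Real.tanh_zero]
    exact monotone_tanh (softplus_nonneg x)
  · exact (tanh_sub_tanh_le (monotone_softplus h)).trans (softplus_sub_le h)
  · refine lt_of_lt_of_le ?_ (hmono (by norm_num : (0 : ℝ) ≤ 1 / 2))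
    simp only [hval, Real.exp_zero]
    norm_num
  · refine le_trans (hmono (by norm_num : (9 / 16 : ℝ) ≤ 1)) ?_
    simp only [hval]
    have h1 := Real.exp_one_lt_d9
    have h2 := Real.exp_pos 1
    rw [div_le_div_iff₀ (by positivity) (by norm_num)]
    nlinarith

lemma quarter_le_overflow_sub {E M : ℕ} (hME : M ≤ 2 ^ (E - 1)) :
    maxFloat E M + 1 / 4 ≤ overflow E M := by
  have h0 := le_two_sub_emin hME
  have h1 := emax_eq E
  unfold overflow eps
  rw [← zpow_add₀ two_ne_zero]
  have : (2 : ℝ) ^ (-2 : ℤ) ≤ 2 ^ (emax E + (-(M : ℤ) - 1)) :=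
    zpow_le_zpow_right₀ (by norm_num) (by omega)
  norm_num at this ⊢
  linarith

lemma exp_neg_two_zpow_emax_lt {E M : ℕ} (hE : 5 ≤ E) (hME : M ≤ 2 ^ (E - 1)) :
    Real.exp (-2 ^ emax E) < 2 ^ (emin E - (M : ℤ) - 1) := by
  have h0 := emin_le hE
  have h1 := le_two_sub_emin hME
  have h2 := emax_eq E
  obtain ⟨q, hq⟩ : ∃ q : ℕ, emax E = q + 3 := ⟨(emax E - 3).toNat, by omega⟩
  obtain ⟨k, hk⟩ : ∃ k : ℕ, (k : ℤ) = M + 1 - emin E := ⟨(M + 1 - emin E).toNat, by omega⟩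
  have h3 : (k : ℝ) ≤ 2 ^ emax E := by
    have h4 : q < 2 ^ q := Nat.lt_two_pow_self
    have h5 : k ≤ 2 ^ (q + 3) := by rw [pow_add]; omega
    rw [hq]
    exact_mod_cast h5
  have h6 : (2 : ℝ) ^ k < Real.exp 1 ^ k :=
    pow_lt_pow_left₀ (by linarith [Real.exp_one_gt_d9]) (by norm_num) (by omega)
  rw [← Real.exp_nat_mul, mul_one] at h6
  rw [show emin E - (M : ℤ) - 1 = -(k : ℤ) by omega, zpow_neg, zpow_natCast, Real.exp_neg]
  have h7 := Real.exp_le_exp.2 h3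
  exact inv_strictAnti₀ (by positivity) (h6.trans_le h7)

lemma exp_bounds {b : ℝ} (hb : b ≤ -13 / 4) :
    1 / 55 ≤ Real.exp (-7 / 2) ∧ Real.exp b ≤ 1 / 16 := by
  have h1 : Real.exp (-3) = (Real.exp 1 ^ 3)⁻¹ := by
    rw [← Real.exp_nat_mul, ← Real.exp_neg]; norm_num
  have h2 : (2.7 : ℝ) ^ 3 ≤ Real.exp 1 ^ 3 :=
    pow_le_pow_left₀ (by norm_num) (by linarith [Real.exp_one_gt_d9]) 3
  have h3 : Real.exp (-4) = (Real.exp 1 ^ 4)⁻¹ := by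
    rw [← Real.exp_nat_mul, ← Real.exp_neg]; norm_num
  have h4 : Real.exp 1 ^ 4 ≤ (2.7183 : ℝ) ^ 4 :=
    pow_le_pow_left₀ (by positivity) (by linarith [Real.exp_one_lt_d9]) 4
  constructor
  · refine le_trans ?_ (Real.exp_le_exp.2 (show (-4 : ℝ) ≤ -7 / 2 by norm_num))
    rw [h3, one_div]
    exact inv_anti₀ (by positivity) (h4.trans (by norm_num))
  · refine (Real.exp_le_exp.2 (show b ≤ -3 by linarith)).trans ?_
    rw [h1, one_div]
    exact inv_anti₀ (by norm_num) (le_trans (by norm_num) h2)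

/-- Monotone functions of slope at most `1` that decay like `exp` at `-∞`. At the threshold
`-7 / 2` the floats are spaced by `4 * ε`, but those in `[1/64, 1/16]` are so much denser that
already a slope larger than `1 / 64` separates them. -/
theorem activationCondition_of_exp_decay {E M : ℕ} (hE : 5 ≤ E) (hM : 3 ≤ M)
    (hME : M ≤ 2 ^ (E - 1)) {f : ℝ → ℝ} (hfin : ∀ x ∈ finiteFloats E M, |f x| < overflow E M)
    (hmono : Monotone f) (hlip : ∀ a b, a ≤ b → f b - f a ≤ b - a) (hnonneg : ∀ x, 0 ≤ f x)
    (hexp : ∀ x, f x ≤ Real.exp x) (h0 : 1 / 4 ≤ f 0) (h0' : f 0 ≤ 1)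
    (hlo : 1 / 64 ≤ f (-7 / 2))
    (hslope : ∀ b, -7 / 2 < b → b ≤ -13 / 4 → (b + 7 / 2) / 64 < f b - f (-7 / 2)) :
    ActivationCondition (correctlyRounded E M f) := by
  have hM1 : 1 ≤ M := by omega
  have h0E := emin_le hE
  have h0E' := emax_eq E
  have hε := eps_pos M
  have hε' := eps_le hM
  have hη := isThreshold_neg hE hM
  have h64 : (1 / 64 : ℝ) ∈ finiteFloats E M := by
    have h := two_zpow_mem (E := E) (M := M) (k := -6) (by omega) (by omega)
    norm_num at h ⊢
    exact h
  have hc₁ := neg_mem_finiteFloats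
    (two_zpow_mem (E := E) (M := M) (k := emax E) (emin_le_emax hE) le_rfl)
  have hpow := two_zpow_pos (emax E)
  have hη1 : -7 / 2 + 4 * eps M ≤ -13 / 4 := by linarith
  have hhi : f (-7 / 2 + 4 * eps M) ≤ 1 / 16 := (hexp _).trans (exp_bounds hη1).2
  have hmid := hmono (show -7 / 2 ≤ -7 / 2 + 4 * eps M by linarith)
  refine activationCondition_of hE hM (L := 1) (c := 1) (b := 1 / 64) hfin ?_ hη ⟨?_, ?_, ?_, ?_⟩
    zero_le_one zero_le_one (by linarith) h64 le_rfl hlo (by linarith) (by norm_num) ?_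
  · refine condZero_of hE hM hfin hc₁ (zero_mem hE) (by linarith)
      (fun x hx => ⟨hmono hx.1, hmono hx.2⟩)
      (roundFin_eq_zero hE hM1 (hnonneg _)
        ((hexp _).trans_lt (exp_neg_two_zpow_emax_lt hE hME))) h0 h0' ?_
    refine le_trans ?_ (le_max_left _ _)
    rw [abs_neg, abs_of_pos hpow]
    exact zpow_le_zpow_right₀ (by norm_num) (by omega)
  · exact fun x hx => hmono hx
  · exact fun y hy => hmono hy
  · exact fun x hx => by rw [one_mul]; exact hlip _ _ hx
  · exact fun y hy => by rw [one_mul]; exact hlip _ _ hy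
  · have := hslope (-7 / 2 + 4 * eps M) (by linarith) hη1
    refine roundFin_lt hE hM1 (e := -5) (by omega) (by omega) (hfin _ hη.mem) (hfin _ hη.mem')
      ?_ ?_ ?_
    · rw [abs_of_nonneg (hnonneg _)]
      norm_num at hmid hhi ⊢
      linarith
    · rw [abs_of_nonneg (hnonneg _)]
      norm_num at hhi ⊢
      linarith
    · norm_num at this ⊢
      linarith

/-- The chord slope of `exp` over `[-7/2, b]`, in the form in which it bounds the chord slopes of
sigmoid and softplus from below. -/
lemma slope_lt_exp_quotient {b : ℝ} (h1 : -7 / 2 < b) (h2 : b ≤ -13 / 4) :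
    (b + 7 / 2) / 64 < (Real.exp b - Real.exp (-7 / 2)) /
      ((1 + Real.exp (-7 / 2)) * (1 + Real.exp b)) := by
  obtain ⟨h3, h4⟩ := exp_bounds h2
  have h5 := Real.exp_pos b
  have h6 := Real.exp_pos (-7 / 2)
  have h7 : Real.exp (-7 / 2) ≤ 1 / 16 := (Real.exp_le_exp.2 h1.le).trans h4
  have h8 : Real.exp (-7 / 2) * (b + 7 / 2) ≤ Real.exp b - Real.exp (-7 / 2) := by
    have h9 := Real.add_one_le_exp (b + 7 / 2)
    have h10 : Real.exp b = Real.exp (-7 / 2) * Real.exp (b + 7 / 2) := by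
      rw [← Real.exp_add]; ring_nf
    rw [h10]
    nlinarith
  rw [lt_div_iff₀ (by positivity)]
  have h11 : (1 + Real.exp (-7 / 2)) * (1 + Real.exp b) ≤ (17 / 16) * (17 / 16) := by
    apply mul_le_mul <;> linarith
  nlinarith

lemma sigmoid_eq (x : ℝ) : sigmoid x = Real.exp x / (1 + Real.exp x) := by
  have := Real.exp_pos x
  unfold sigmoid
  rw [Real.exp_neg]
  field_simp
  ring

lemma sigmoid_sub (a b : ℝ) : sigmoid b - sigmoid a =
    (Real.exp b - Real.exp a) / ((1 + Real.exp a) * (1 + Real.exp b)) := by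
  have := Real.exp_pos a
  have := Real.exp_pos b
  rw [sigmoid_eq, sigmoid_eq]
  field_simp
  ring

lemma monotone_sigmoid : Monotone sigmoid := by
  intro a b h
  have h1 := Real.exp_le_exp.2 h
  have h2 : 0 ≤ sigmoid b - sigmoid a := by
    rw [sigmoid_sub]
    have := Real.exp_pos a
    have := Real.exp_pos b
    exact div_nonneg (by linarith) (by positivity)
  linarith

lemma sigmoid_sub_le {a b : ℝ} (h : a ≤ b) : sigmoid b - sigmoid a ≤ b - a := by
  have ha := Real.exp_pos a
  have hb := Real.exp_pos b
  rw [sigmoid_sub, div_le_iff₀ (by positivity)]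
  have h1 := Real.add_one_le_exp (a - b)
  have h2 : Real.exp a = Real.exp b * Real.exp (a - b) := by
    rw [← Real.exp_add]; ring_nf
  have h3 : Real.exp b - Real.exp a ≤ (b - a) * Real.exp b := by
    rw [h2]; nlinarith
  have h4 : Real.exp b ≤ (1 + Real.exp a) * (1 + Real.exp b) := by nlinarith
  exact h3.trans (by gcongr)

lemma sigmoid_nonneg (x : ℝ) : 0 ≤ sigmoid x := by
  unfold sigmoid; positivity

lemma le_sigmoid_threshold : 1 / 64 ≤ sigmoid (-7 / 2) := by
  have h := (exp_bounds (le_refl (-13 / 4))).1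
  rw [sigmoid_eq, le_div_iff₀ (by positivity)]
  linarith

theorem activationCondition_sigmoid {E M : ℕ} (hE : 5 ≤ E) (hM : 3 ≤ M)
    (hME : M ≤ 2 ^ (E - 1)) : ActivationCondition (correctlyRounded E M sigmoid) := by
  have h0 : sigmoid 0 = 1 / 2 := by norm_num [sigmoid]
  refine activationCondition_of_exp_decay hE hM hME (fun x _ => ?_) monotone_sigmoid
    (fun a b => sigmoid_sub_le) sigmoid_nonneg (fun x => ?_) (by rw [h0]; norm_num)
    (by rw [h0]; norm_num) le_sigmoid_threshold (fun b h1 h2 => ?_)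
  · have h1 : sigmoid x ≤ 1 := by
      rw [sigmoid_eq, div_le_one (by positivity)]
      linarith
    rw [abs_of_nonneg (sigmoid_nonneg x)]
    linarith [two_lt_overflow (M := M) hE]
  · rw [sigmoid_eq]
    exact div_le_self (Real.exp_pos x).le (by linarith [Real.exp_pos x])
  · rw [sigmoid_sub]
    exact slope_lt_exp_quotient h1 h2

/-- The derivative of softplus is the sigmoid; chord slopes are estimated directly with
`log u ≥ 1 - 1 / u`. -/
lemma le_softplus_sub (a b : ℝ) :
    (Real.exp b - Real.exp a) / (1 + Real.exp b) ≤ softplus b - softplus a := by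
  have ha := Real.exp_pos a
  have hb := Real.exp_pos b
  unfold softplus
  rw [← Real.log_div (by positivity) (by positivity)]
  refine le_trans (le_of_eq ?_) (Real.one_sub_inv_le_log_of_pos (by positivity))
  field_simp
  ring

lemma softplus_lt_add {x : ℝ} (hx : 2 ≤ x) : softplus x < x + 1 / 4 := by
  have h1 : 1 + Real.exp x = Real.exp x * (1 + Real.exp (-x)) := by
    rw [mul_add, ← Real.exp_add]; simp [add_comm]
  have h2 : softplus x = x + softplus (-x) := by
    unfold softplus
    rw [h1, Real.log_mul (by positivity) (by positivity), Real.log_exp]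
  have h3 : Real.exp (-2) = (Real.exp 1 ^ 2)⁻¹ := by
    rw [← Real.exp_nat_mul, ← Real.exp_neg]; norm_num
  have h4 : (2.7 : ℝ) ^ 2 ≤ Real.exp 1 ^ 2 :=
    pow_le_pow_left₀ (by norm_num) (by linarith [Real.exp_one_gt_d9]) 2
  have h5 : Real.exp (-x) < 1 / 4 := by
    refine (Real.exp_le_exp.2 (show -x ≤ -2 by linarith)).trans_lt ?_
    rw [h3, one_div]
    exact inv_strictAnti₀ (by norm_num) (lt_of_lt_of_le (by norm_num) h4)
  linarith [softplus_le_exp (-x)]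

theorem activationCondition_softplus {E M : ℕ} (hE : 5 ≤ E) (hM : 3 ≤ M)
    (hME : M ≤ 2 ^ (E - 1)) : ActivationCondition (correctlyRounded E M softplus) := by
  have h0 : softplus 0 = Real.log 2 := by norm_num [softplus]
  have hmax := (le_abs_self _).trans (abs_le_maxFloat (two_mem (M := M) hE))
  refine activationCondition_of_exp_decay hE hM hME (fun x hx => ?_) monotone_softplus
    (fun a b => softplus_sub_le) softplus_nonneg softplus_le_exp
    (by rw [h0]; linarith [Real.log_two_gt_d9]) (by rw [h0]; linarith [Real.log_two_lt_d9])
    ?_ (fun b h1 h2 => ?_)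
  · rw [abs_of_nonneg (softplus_nonneg x)]
    have h1 := monotone_softplus ((le_abs_self x).trans (abs_le_maxFloat hx))
    linarith [softplus_lt_add hmax, quarter_le_overflow_sub (E := E) (M := M) hME]
  · refine le_sigmoid_threshold.trans ?_
    have := Real.one_sub_inv_le_log_of_pos (x := 1 + Real.exp (-7 / 2)) (by positivity)
    unfold softplus
    refine le_trans (le_of_eq ?_) this
    rw [sigmoid_eq]
    field_simp
    ring
  · refine (slope_lt_exp_quotient h1 h2).trans_le (le_trans ?_ (le_softplus_sub _ _))
    have ha := Real.exp_pos (-7 / 2)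
    have hb := Real.exp_pos b
    have hab := Real.exp_le_exp.2 h1.le
    refine div_le_div_of_nonneg_left (by linarith) (by positivity) ?_
    nlinarith

/-! ### GELU -/

section Gaussian

open MeasureTheory ProbabilityTheory

lemma gaussianPDFReal_le_half (x : ℝ) : gaussianPDFReal 0 1 x ≤ 1 / 2 := by
  have h1 : (2 : ℝ) ≤ √(2 * Real.pi) :=
    Real.le_sqrt_of_sq_le (by nlinarith [Real.pi_gt_three])
  have h2 : Real.exp (-(x - 0) ^ 2 / (2 * 1)) ≤ 1 :=
    Real.exp_le_one_iff.2 (by nlinarith [sq_nonneg x])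
  have h3 : (√(2 * Real.pi))⁻¹ ≤ 1 / 2 := by
    rw [one_div]; exact inv_anti₀ (by norm_num) h1
  simp only [gaussianPDFReal, NNReal.coe_one, mul_one] at h2 ⊢
  calc _ ≤ (1 / 2 : ℝ) * 1 := by gcongr
    _ = _ := by norm_num

lemma cdf_gaussian_sub {a b : ℝ} (h : a ≤ b) :
    cdf (gaussianReal 0 1) b - cdf (gaussianReal 0 1) a = (gaussianReal 0 1).real (Set.Ioc a b) := by
  have h1 : Set.Ioc a b = Set.Iic b \ Set.Iic a := by
    ext x
    simp [and_comm]
  rw [cdf_eq_real, cdf_eq_real, h1,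
    measureReal_sdiff (Set.Iic_subset_Iic.2 h) measurableSet_Iic]

lemma cdf_gaussian_sub_le {a b : ℝ} (h : a ≤ b) :
    cdf (gaussianReal 0 1) b - cdf (gaussianReal 0 1) a ≤ (b - a) / 2 := by
  rw [cdf_gaussian_sub h, Measure.real, gaussianReal_apply_eq_integral 0 one_ne_zero,
    ENNReal.toReal_ofReal (integral_nonneg fun x => gaussianPDFReal_nonneg 0 1 x)]
  have := norm_setIntegral_le_of_norm_le_const (μ := volume) (s := Set.Ioc a b) (C := 1 / 2)
    (f := gaussianPDFReal 0 1) (by simp) (fun x _ => by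
      rw [Real.norm_of_nonneg (gaussianPDFReal_nonneg 0 1 x)]
      exact gaussianPDFReal_le_half x)
  rw [Real.volume_real_Ioc_of_le h] at this
  linarith [Real.le_norm_self (∫ x in Set.Ioc a b, gaussianPDFReal 0 1 x)]

lemma cdf_gaussian_lt {a b : ℝ} (h : a < b) :
    cdf (gaussianReal 0 1) a < cdf (gaussianReal 0 1) b := by
  have h1 := cdf_gaussian_sub h.le
  have h2 : (gaussianReal 0 1) (Set.Ioc a b) ≠ 0 := fun h0 => by
    have := gaussianReal_absolutelyContinuous' 0 one_ne_zero h0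
    rw [Real.volume_Ioc, ENNReal.ofReal_eq_zero] at this
    linarith
  have h3 : 0 < (gaussianReal 0 1).real (Set.Ioc a b) :=
    ENNReal.toReal_pos h2 (measure_ne_top _ _)
  linarith

lemma cdf_gaussian_zero : cdf (gaussianReal 0 1) 0 = 1 / 2 := by
  have := nullSingletonClass_gaussianReal (μ := 0) (v := 1) one_ne_zero
  have h1 : (gaussianReal 0 1).real (Set.Iic 0) = (gaussianReal 0 1).real (Set.Ioi 0) := by
    have h2 := gaussianReal_map_neg (μ := 0) (v := 1)
    rw [neg_zero] at h2
    conv_lhs => rw [← h2]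
    rw [map_measureReal_apply measurable_neg measurableSet_Iic]
    have : (fun x : ℝ => -x) ⁻¹' Set.Iic 0 = Set.Ici 0 := by ext; simp
    rw [this]
    exact measureReal_congr Ioi_ae_eq_Ici.symm
  have h3 := probReal_compl_eq_one_sub (μ := gaussianReal 0 1) (measurableSet_Iic (a := (0 : ℝ)))
  rw [Set.compl_Iic, ← h1] at h3
  rw [cdf_eq_real]
  linarith

theorem activationCondition_gelu {E M : ℕ} (hE : 5 ≤ E) (hM : 3 ≤ M) :
    ActivationCondition (correctlyRounded E M gelu) := by
  refine activationCondition_of_gate hE hM (T := cdf (gaussianReal 0 1))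
    (monotone_cdf _) (cdf_nonneg _) (cdf_le_one _) (fun a b h => ?_) ?_ ?_
  · linarith [cdf_gaussian_sub_le h]
  · have := cdf_gaussian_lt (show (0 : ℝ) < 1 / 2 by norm_num)
    rwa [cdf_gaussian_zero] at this
  · have := cdf_gaussian_sub_le (show (0 : ℝ) ≤ 9 / 16 by norm_num)
    rw [cdf_gaussian_zero] at this
    linarith

end Gaussian

end FloatIUA

theorem corollary1 (E M : ℕ) (hE : 5 ≤ E) (hM : 3 ≤ M) (hME : M ≤ 2 ^ (E - 1)) :
    FloatIUA.ActivationCondition (FloatIUA.correctlyRounded E M FloatIUA.relu) ∧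
    (∀ a : ℝ, 0 ≤ a → a ≤ 1 →
      FloatIUA.ActivationCondition (FloatIUA.correctlyRounded E M (FloatIUA.leakyReLU a))) ∧
    FloatIUA.ActivationCondition (FloatIUA.correctlyRounded E M FloatIUA.gelu) ∧
    (∀ α : ℝ, 0 ≤ α → α ≤ 1 →
      FloatIUA.ActivationCondition (FloatIUA.correctlyRounded E M (FloatIUA.elu α))) ∧
    FloatIUA.ActivationCondition (FloatIUA.correctlyRounded E M FloatIUA.mish) ∧
    FloatIUA.ActivationCondition (FloatIUA.correctlyRounded E M FloatIUA.softplus) ∧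
    FloatIUA.ActivationCondition (FloatIUA.correctlyRounded E M FloatIUA.sigmoid) ∧
    FloatIUA.ActivationCondition (FloatIUA.correctlyRounded E M Real.tanh) := by
  exact ⟨FloatIUA.activationCondition_relu hE hM,
    fun _ h0 h1 => FloatIUA.activationCondition_leakyReLU hE hM h0 h1,
    FloatIUA.activationCondition_gelu hE hM,
    fun _ h0 h1 => FloatIUA.activationCondition_elu hE hM h0 h1,
    FloatIUA.activationCondition_mish hE hM,
    FloatIUA.activationCondition_softplus hE hM hME,
    FloatIUA.activationCondition_sigmoid hE hM hME,
    FloatIUA.activationCondition_tanh hE hM⟩
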